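/- **Setting.** The torus $T^m=\mathbb R^m/2\pi\mathbb Z^m$ acts by isometries on a $2n$-dimensional Riemannian manifold with fixed point $\bar x$. Near $\bar x$ let $E$ be a $T^m$-equivariant Hermitian Clifford bundle of rank $r$ (Clifford multiplication $c$ skew-Hermitian, $c(v)c(w)+c(w)c(v)=-2\langle v,w\rangle$) with equivariant Hermitian Clifford connection $\nabla$ and Dirac operator $D=\sum c\circ\nabla$. Use equivariant coordinates centred at $\bar x$, orthonormal at $\bar x$, and an equivariant unitary trivialization of $E$ (for example geodesic normal coordinates and radial parallel transport), such that $\theta\in T^m$ acts by $(z_1,\dots,z_n)\theta=(e^{i\mathbf k_1\cdot\theta}z_1,\dots,e^{i\mathbf k_n\cdot\theta}z_n)$ on $T_{\bar x}M\cong\mathbb C^n=\mathbb R^{2n}$, $z_l=x_l+iy_l$, and by $F_\theta(w_1,\dots,w_r)=(e^{i\mathbf a_1\cdot\theta}w_1,\dots,e^{i\mathbf a_r\cdot\theta}w_r)$ on $E_{\bar x}\cong\mathbb C^r$, with $\mathbf k_l,\mathbf a_j\in\mathbb Z^m$. Let $\tau\in\mathbb R^m$ be such that $\{t\tau: t\in\mathbb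 R\}$ is dense in $T^m$, let $V$ be the vector field induced by $\tau$, suppose $\kappa_l:=\mathbf k_l\cdot\tau>0$ for all $l$, and put $Z=c(iV)$. Suppose the basis $e_1,\dots,e_r$ of $E_{\bar x}$ also satisfies $i\,c(\partial_{x_l})c(\partial_{y_l})e_j=\varepsilon_{jl}e_j$ at $\bar x$ (so $\varepsilon_{jl}\in\{\pm1\}$). Fix $\rho(\theta)=e^{i\mathbf b\cdot\theta}$, $\mathbf b\in\mathbb Z^m$. A section $u$ is of type $\rho$ if $F_{-\theta}(u(x\theta))=e^{i\mathbf b\cdot\theta}u(x)$ for all $\theta$. Write $\frac1s(D+sZ)^2=\frac1sA+B+sC$, i.e. $A=D^2$, $B=DZ+ZD$, $C=Z^2$. If $\beta$ is a continuous bundle map near $\bar x$ with $Bu=\beta u$ for all smooth $u$ of type $\rho$, the model operator is $K^\rho_{\bar x}=\widetilde A+\beta(\bar x)+\widetilde C$, where $\widetilde A$ is the principal part of $A$ at $\bar x$ and $\widetilde C$ is the quadratic part of $C$ at $\bar x$. It is regarded as an unbounded operator in the space $L^2(\mathbb R^{2n},E_{\bar x})^\rho$ of square integrable sections of type $\rho$,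 as the closure of its restriction to Schwartz sections of type $\rho$. **Theorem.** Such a $\beta$ exists. For every such $\beta$: 1. On smooth sections $u=\sum_j u_je_j$ of type $\rho$ on $\mathbb R^{2n}$, the model operator is the harmonic oscillator $$(K^\rho_{\bar x}u)_j=\sum_{l=1}^n\left(-\partial_{x_l}^2-\partial_{y_l}^2+\kappa_l^2|z_l|^2\right)u_j+\Big(2\,\mathbf b\cdot\tau+2\,\mathbf a_j\cdot\tau+2\sum_{l=1}^n\kappa_l\varepsilon_{jl}\Big)u_j .$$ 2. The spectrum of $K^\rho_{\bar x}$ is the set of real numbers $$\lambda=2\sum_{l=1}^n\kappa_l\left(|m_l|+m_l+2d_l+1+\varepsilon_{jl}\right)$$ with $j\in\{1,\dots,r\}$, $\mathbf m\in\mathbb Z^n$, $\mathbf d\in(\mathbb Z_{\ge0})^n$ such that $\sum_{h=1}^n m_h\mathbf k_h=\mathbf a_j+\mathbf b$. 3. For every real $\lambda$ the multiplicity $\dim\ker(K^\rho_{\bar x}-\lambda)$ is finite and equals the (finite) number of triples $(j,\mathbf m,\mathbf d)\in\{1,\dots,r\}\times\mathbb Z^n\times(\mathbb Z_{\ge0})^n$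 with $$\sum_{h=1}^n m_h\mathbf k_h=\mathbf a_j+\mathbf b\quad\text{and}\quad 2\sum_{l=1}^n\kappa_l\left(|m_l|+m_l+2d_l+1+\varepsilon_{jl}\right)=\lambda .$$ -/

import Mathlib

open Set MeasureTheory
open scoped ContDiff SchwartzMap InnerProductSpace

noncomputable section

namespace WittenModel

/-- `k · θ` for an integral weight `k ∈ ℤ^m` and `θ ∈ ℝ^m`. -/
def pairing {m : ℕ} (k : Fin m → ℤ) (θ : Fin m → ℝ) : ℝ :=
  ∑ p, (k p : ℝ) * θ p

/-- The diagonal action of `θ ∈ ℝ^m` (which factors through the torus `ℝ^m / 2πℤ^m`) on `ℂ^N` with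
weights `w₁, …, w_N ∈ ℤ^m`:
`(z₁, …, z_N) ↦ (e^{i w₁·θ} z₁, …, e^{i w_N·θ} z_N)`. -/
def torusAct {m N : ℕ} (w : Fin N → Fin m → ℤ) (θ : Fin m → ℝ)
    (z : EuclideanSpace ℂ (Fin N)) : EuclideanSpace ℂ (Fin N) :=
  WithLp.toLp 2 fun j => Complex.exp (Complex.I * (pairing (w j) θ : ℝ)) * z j

/-- The tangent space `T_x̄ M ≅ ℂ^n ≅ ℝ^{2n}` at the fixed point, a real Euclidean space of
dimension `2n`, with coordinates `z_l = x_l + i y_l`. -/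
abbrev Tangent (n : ℕ) : Type := EuclideanSpace ℂ (Fin n)

/-- The fibre `E_x̄ ≅ ℂ^r` in Hermitian coordinates `(w₁, …, w_r)`. -/
abbrev Fiber (r : ℕ) : Type := EuclideanSpace ℂ (Fin r)

/-- The real orthonormal basis of `ℂ^n`: `(l, 0)` gives `∂_{x_l}` and `(l, 1)` gives `∂_{y_l}`. -/
def realBasis {n : ℕ} (p : Fin n × Fin 2) : Tangent n :=
  EuclideanSpace.single p.1 (if p.2 = 0 then (1 : ℂ) else Complex.I)

/-- `γ` is the Christoffel vector `Γ_x(v, w)` of the Levi-Civita connection of the metric `g`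
at `x`: the covariant derivative in direction `v` of the constant vector field `w`, as given by
the Koszul formula. -/
def IsChristoffel {n : ℕ} (g : Tangent n → Tangent n →L[ℝ] Tangent n →L[ℝ] ℝ)
    (x v w γ : Tangent n) : Prop :=
  ∀ y : Tangent n,
    2 * g x γ y = fderiv ℝ g x v w y + fderiv ℝ g x w v y - fderiv ℝ g x y v w

/-- The section `u` is of type `ρ(θ) = e^{i b·θ}` over `U`, for the action
`(ψ_θ u)(x) = F_{-θ} (u (x θ))`, where `θ` acts on the base with weights `k` and on the fibre
with weights `a`. -/
def IsOfType {n m r : ℕ} (k : Fin n → Fin m → ℤ) (a : Fin r → Fin m → ℤ) (b : Fin m → ℤ)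
    (U : Set (Tangent n)) (u : Tangent n → Fiber r) : Prop :=
  ∀ θ : Fin m → ℝ, ∀ x ∈ U,
    torusAct a (-θ) (u (torusAct k θ x)) =
      Complex.exp (Complex.I * (pairing b θ : ℝ)) • u x

/-- An equivariant Clifford bundle with equivariant Clifford connection over a neighbourhood `U`
of a fixed point of an isometric action of the torus `T^m`, written in equivariant coordinates
centred at the fixed point (for example geodesic normal coordinates, and the trivialization of
the bundle by parallel translation along the geodesics through the centre).  The torus acts on
the base with weights `k` and on the fibre with weights `a`. -/
structure CliffordGerm {n m r : ℕ} (k : Fin n → Fin m → ℤ) (a : Fin r → Fin m → ℤ) where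
  /-- The coordinate neighbourhood; the fixed point is the origin. -/
  U : Set (Tangent n)
  isOpen_U : IsOpen U
  zero_mem : (0 : Tangent n) ∈ U
  act_mem : ∀ θ : Fin m → ℝ, ∀ x ∈ U, torusAct k θ x ∈ U
  /-- The Riemannian metric. -/
  g : Tangent n → Tangent n →L[ℝ] Tangent n →L[ℝ] ℝ
  g_smooth : ContDiffOn ℝ ∞ g U
  g_symm : ∀ x ∈ U, ∀ v w, g x v w = g x w v
  g_pos : ∀ x ∈ U, ∀ v, v ≠ 0 → 0 < g x v v
  /-- The coordinates are orthonormal at the fixed point. -/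
  g_zero : ∀ v w, g 0 v w = ⟪v, w⟫_ℝ
  g_equivariant : ∀ θ : Fin m → ℝ, ∀ x ∈ U, ∀ v w,
    g (torusAct k θ x) (torusAct k θ v) (torusAct k θ w) = g x v w
  /-- Clifford multiplication by tangent vectors (tangent and cotangent vectors are identified by
  the metric). -/
  c : Tangent n → Tangent n →L[ℝ] (Fiber r →L[ℂ] Fiber r)
  c_smooth : ContDiffOn ℝ ∞ c U
  c_clifford : ∀ x ∈ U, ∀ v w,
    c x v ∘L c x w + c x w ∘L c x v =
      -(((2 * g x v w : ℝ) : ℂ) • ContinuousLinearMap.id ℂ (Fiber r))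
  c_skew : ∀ x ∈ U, ∀ v, ContinuousLinearMap.adjoint (c x v) = -c x v
  c_equivariant : ∀ θ : Fin m → ℝ, ∀ x ∈ U, ∀ v e,
    torusAct a θ (c x v e) = c (torusAct k θ x) (torusAct k θ v) (torusAct a θ e)
  /-- The connection form: `∇_v u = ∂_v u + conn(v) u`. -/
  conn : Tangent n → Tangent n →L[ℝ] (Fiber r →L[ℂ] Fiber r)
  conn_smooth : ContDiffOn ℝ ∞ conn U
  conn_skew : ∀ x ∈ U, ∀ v, ContinuousLinearMap.adjoint (conn x v) = -conn x v
  conn_equivariant : ∀ θ : Fin m → ℝ, ∀ x ∈ U, ∀ v e,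
    torusAct a θ (conn x v e) = conn (torusAct k θ x) (torusAct k θ v) (torusAct a θ e)
  /-- `[∇_v, c(w)] = c(∇_v w)`: the connection is a Clifford connection. -/
  clifford_connection : ∀ x ∈ U, ∀ v w γ, IsChristoffel g x v w γ →
    fderiv ℝ c x v w + (conn x v ∘L c x w - c x w ∘L conn x v) = c x γ

/-- The vector field on the base induced by the element `τ ∈ ℝ^m` of the Lie algebra of `T^m`. -/
def inducedField {n m : ℕ} (k : Fin n → Fin m → ℤ) (τ : Fin m → ℝ) (x : Tangent n) : Tangent n :=
  deriv (fun t : ℝ => torusAct k (t • τ) x) 0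

/-- The principal part at the origin of a second order differential operator `P`: the constant
coefficient operator whose value on `u` at `x` is `P` applied at the origin to the homogeneous
second order part `y ↦ ½ D²u(x)(y, y)` of the Taylor expansion of `u` at `x`.  Thus
`∑ p_{ij}(y) ∂_i ∂_j + (lower order)` becomes `∑ p_{ij}(0) ∂_i ∂_j`. -/
def principalPart {n r : ℕ} (P : (Tangent n → Fiber r) → (Tangent n → Fiber r))
    (u : Tangent n → Fiber r) (x : Tangent n) : Fiber r :=
  P (fun y => (1 / 2 : ℝ) • iteratedFDeriv ℝ 2 u x ![y, y]) 0

/-- The quadratic part at the origin of an endomorphism-valued function. -/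
def quadraticPart {n r : ℕ} (C : Tangent n → (Fiber r →L[ℂ] Fiber r)) (x : Tangent n) :
    Fiber r →L[ℂ] Fiber r :=
  (1 / 2 : ℝ) • iteratedFDeriv ℝ 2 C 0 ![x, x]

namespace CliffordGerm

variable {n m r : ℕ} {k : Fin n → Fin m → ℤ} {a : Fin r → Fin m → ℤ} (S : CliffordGerm k a)

/-- The covariant derivative `∇_v u` at `x`. -/
def nabla (u : Tangent n → Fiber r) (x v : Tangent n) : Fiber r :=
  fderiv ℝ u x v + S.conn x v (u x)

/-- The matrix `g_{pq}` of the metric at `x`. -/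
def gram (x : Tangent n) : Matrix (Fin n × Fin 2) (Fin n × Fin 2) ℝ :=
  Matrix.of fun p q => S.g x (realBasis p) (realBasis q)

/-- The Dirac operator `D = ∑ g^{pq} c(∂_p) ∇_{∂_q}`. -/
def dirac (u : Tangent n → Fiber r) (x : Tangent n) : Fiber r :=
  ∑ p, ∑ q, (S.gram x)⁻¹ p q • S.c x (realBasis p) (S.nabla u x (realBasis q))

/-- The bundle map `Z = c(iV) = i c(V)`, where `V` is the vector field induced by `τ`. -/
def Z (τ : Fin m → ℝ) (x : Tangent n) : Fiber r →L[ℂ] Fiber r :=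
  Complex.I • S.c x (inducedField k τ x)

/-- The operator `B = DZ + ZD`, the term of order zero in `s` of `(1/s) (D + sZ)²`. -/
def anticommutator (τ : Fin m → ℝ) (u : Tangent n → Fiber r) (x : Tangent n) : Fiber r :=
  S.dirac (fun y => S.Z τ y (u y)) x + S.Z τ x (S.dirac u x)

/-- The restriction of `B = DZ + ZD` to sections of type `ρ = e^{i b·θ}` is the bundle
map `β`. -/
def IsRestriction (τ : Fin m → ℝ) (b : Fin m → ℤ)
    (β : Tangent n → (Fiber r →L[ℂ] Fiber r)) : Prop :=
  ContinuousOn β S.U ∧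
    ∀ u : Tangent n → Fiber r, ContDiffOn ℝ ∞ u S.U → IsOfType k a b S.U u →
      ∀ x ∈ S.U, S.anticommutator τ u x = β x (u x)

/-- The model operator `K = Ã + B̃ + C̃`, where `(1/s) (D + sZ)² = (1/s) A + B + s C`: the
principal part `Ã` of `A = D²` at the fixed point, the value `B̃ = β 0` at the fixed point of the
bundle map to which `B` restricts, and the quadratic part `C̃` of `C = Z²`. -/
def modelOperator (τ : Fin m → ℝ) (β : Tangent n → (Fiber r →L[ℂ] Fiber r))
    (u : Tangent n → Fiber r) (x : Tangent n) : Fiber r :=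
  principalPart (fun v => S.dirac (S.dirac v)) u x + β 0 (u x) +
    quadraticPart (fun y => S.Z τ y ∘L S.Z τ y) x (u x)

end CliffordGerm

/-- The diagonal torus action as a linear isometry. -/
def torusIso {m N : ℕ} (w : Fin N → Fin m → ℤ) (θ : Fin m → ℝ) :
    EuclideanSpace ℂ (Fin N) ≃ₗᵢ[ℝ] EuclideanSpace ℂ (Fin N) :=
  LinearIsometryEquiv.piLpCongrRight 2 fun j => rotation (Circle.exp (pairing (w j) θ))

theorem torusIso_apply {m N : ℕ} (w : Fin N → Fin m → ℤ) (θ : Fin m → ℝ)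
    (z : EuclideanSpace ℂ (Fin N)) : torusIso w θ z = torusAct w θ z := by
  ext j
  simp [torusIso, torusAct, Circle.coe_exp, mul_comm Complex.I]

theorem measurePreserving_torusAct {m N : ℕ} (w : Fin N → Fin m → ℤ) (θ : Fin m → ℝ) :
    MeasurePreserving (torusAct w θ) (volume : Measure (EuclideanSpace ℂ (Fin N))) volume := by
  have h := (torusIso w θ).measurePreserving
  rwa [show ⇑(torusIso w θ) = torusAct w θ from funext (torusIso_apply w θ)] at h

theorem torusAct_add {m N : ℕ} (w : Fin N → Fin m → ℤ) (θ : Fin m → ℝ)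
    (z z' : EuclideanSpace ℂ (Fin N)) :
    torusAct w θ (z + z') = torusAct w θ z + torusAct w θ z' := by
  ext j
  simp [torusAct, mul_add]

theorem torusAct_smul {m N : ℕ} (w : Fin N → Fin m → ℤ) (θ : Fin m → ℝ) (s : ℂ)
    (z : EuclideanSpace ℂ (Fin N)) :
    torusAct w θ (s • z) = s • torusAct w θ z := by
  ext j
  simp [torusAct, mul_left_comm]

/-- The Hilbert space `L²(ℝ^{2n}, E_x̄)^ρ` of square integrable sections of type
`ρ = e^{i b·θ}`. -/
def L2OfType {n m r : ℕ} (k : Fin n → Fin m → ℤ) (a : Fin r → Fin m → ℤ) (b : Fin m → ℤ) :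
    Submodule ℂ (Lp (Fiber r) 2 (volume : Measure (Tangent n))) where
  carrier := {f | ∀ θ : Fin m → ℝ, ∀ᵐ x : Tangent n,
    torusAct a (-θ) (f (torusAct k θ x)) = Complex.exp (Complex.I * (pairing b θ : ℝ)) • f x}
  zero_mem' := by
    intro θ
    have h := Lp.coeFn_zero (Fiber r) 2 (volume : Measure (Tangent n))
    filter_upwards [h, (measurePreserving_torusAct k θ).quasiMeasurePreserving.ae h] with x h1 h2
    rw [h1, h2]
    ext j
    simp [torusAct]
  add_mem' := by
    intro f f' hf hf' θ
    have h := Lp.coeFn_add f f'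
    filter_upwards [h, (measurePreserving_torusAct k θ).quasiMeasurePreserving.ae h, hf θ, hf' θ]
      with x h1 h2 h3 h4
    rw [h1, h2, Pi.add_apply, Pi.add_apply, torusAct_add, h3, h4, smul_add]
  smul_mem' := by
    intro s f hf θ
    have h := Lp.coeFn_smul s f
    filter_upwards [h, (measurePreserving_torusAct k θ).quasiMeasurePreserving.ae h, hf θ]
      with x h1 h2 h3
    rw [h1, h2, Pi.smul_apply, Pi.smul_apply, torusAct_smul, h3, smul_comm]

section ClosedOperator

variable {H : Type*} [NormedAddCommGroup H] [NormedSpace ℂ H]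

/-- The spectrum of the operator `T` in `H` with graph `Γ`: the complement of the set of those
`z ∈ ℂ` for which `T - z` has an everywhere defined bounded two-sided inverse `R`. -/
def graphSpectrum (Γ : Submodule ℂ (H × H)) : Set ℂ :=
  {z | ¬ ∃ R : H →L[ℂ] H,
    (∀ f : H, (R f, f + z • R f) ∈ Γ) ∧ ∀ u f : H, (u, f) ∈ Γ → R (f - z • u) = u}

/-- The eigenspace `ker (T - z)` of the operator `T` with graph `Γ`. -/
def graphEigenspace (Γ : Submodule ℂ (H × H)) (z : ℂ) : Submodule ℂ H :=
  Γ.comap (LinearMap.prod LinearMap.id (z • LinearMap.id))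

end ClosedOperator

/-- The graph of the model operator as an unbounded operator in `L²(ℝ^{2n}, E_x̄)^ρ`: the closure
of its graph on Schwartz sections of type `ρ`. -/
def modelGraph {n m r : ℕ} {k : Fin n → Fin m → ℤ} {a : Fin r → Fin m → ℤ} (S : CliffordGerm k a)
    (τ : Fin m → ℝ) (b : Fin m → ℤ) (β : Tangent n → (Fiber r →L[ℂ] Fiber r)) :
    Submodule ℂ (L2OfType k a b × L2OfType k a b) :=
  (Submodule.span ℂ {p : L2OfType k a b × L2OfType k a b |
    ∃ s : 𝓢(Tangent n, Fiber r), IsOfType k a b univ s ∧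
      (p.1.1 =ᵐ[volume] (s : Tangent n → Fiber r)) ∧
      (p.2.1 =ᵐ[volume] S.modelOperator τ β s)}).topologicalClosure

/-- The number `2 ∑_l κ_l (|m_l| + m_l + 2 d_l + 1 + ε_{jl})` with `κ_l = k_l · τ`. -/
def eigenvalue {n m r : ℕ} (k : Fin n → Fin m → ℤ) (τ : Fin m → ℝ) (ε : Fin r → Fin n → ℤ)
    (j : Fin r) (μ : Fin n → ℤ) (d : Fin n → ℕ) : ℝ :=
  2 * ∑ l, pairing (k l) τ * (|(μ l : ℝ)| + μ l + 2 * d l + 1 + ε j l)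

/-- The triples `(j, μ, d)` with `∑_h μ_h k_h = a_j + b` whose number
`2 ∑_l κ_l (|μ_l| + μ_l + 2 d_l + 1 + ε_{jl})` is `lam`. -/
def eigenTriples {n m r : ℕ} (k : Fin n → Fin m → ℤ) (a : Fin r → Fin m → ℤ) (b : Fin m → ℤ)
    (τ : Fin m → ℝ) (ε : Fin r → Fin n → ℤ) (lam : ℝ) :
    Set (Fin r × (Fin n → ℤ) × (Fin n → ℕ)) :=
  {t | ∑ h, t.2.1 h • k h = a t.1 + b ∧ eigenvalue k τ ε t.1 t.2.1 t.2.2 = lam}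

end WittenModel

end

open WittenModel

/-! The three parts of the model operator are computed at the fixed point. Expanding `D² q` for a
quadratic section `q` leaves only symmetrized Clifford products, so the principal part is minus the
Laplacian (`principalPart_eq`). Since `Z` vanishes at the origin with derivative `i c(V x)`, the
quadratic part of `Z²` is `|V x|² = ∑ κ_l² |z_l|²` (`quadraticPart_eq`). In `DZ + ZD` the first
order terms combine by the Clifford relation to `-2i ∂_V`. On sections of type `ρ` the derivative
`∂_V` is multiplication by `i (a_j + b)·τ`, so an endomorphism remains (`anticommutator_eq`). At the
origin its other part is `i ∑ c(e_p) c(∂_p V)`, with eigenvalues `2 ∑ κ_l ε_{jl}`. Another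
admissible `β` may differ at the origin, but not on values of sections of type `ρ`
(`IsRestriction.apply_zero`).

What is left is a scalar oscillator plus a constant in each component. Ladder operators built from
`z_l` and its conjugate give orthogonal eigenfunctions `state hκ α`, complete because a square
integrable function without Gaussian moments is zero (`ae_eq_zero_of_gaussian_moments`). They are
also weight vectors of the torus (`state_torusAct`), so those with weight `a_j + b`, placed in
component `j`, form a Hilbert basis of the sections of type `ρ` (`stateBasis`).

These basis vectors are Schwartz sections, and pairing with them is symmetric on all Schwartz
sections, so the closure is the maximal diagonal operator (`modelGraph_eq_diagonalGraph`). Its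
eigenvalues have finite multiplicity and no finite accumulation point, hence they are the whole
spectrum. The weight condition turns energy plus constant into `∑ 2 κ_l (2 α_{l,0} + 1 + ε_{jl})`,
and the substitution `m = α_{l,0} - α_{l,1}`, `d = min (α_{l,0}, α_{l,1})` gives the stated
parametrization (`image_stateTriple`). -/

namespace WittenModel

/-! ### Diagonal operators in a Hilbert basis: closure, spectrum, eigenspaces. -/

section DiagonalOperators

variable {H ι : Type*} [NormedAddCommGroup H] [InnerProductSpace ℂ H]

/-- The graph of the maximal diagonal operator `e i ↦ lam i • e i`. -/
def diagonalGraph (e : HilbertBasis ι ℂ H) (lam : ι → ℝ) : Submodule ℂ (H × H) where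
  carrier := {p | ∀ i, ⟪e i, p.2⟫_ℂ = lam i * ⟪e i, p.1⟫_ℂ}
  zero_mem' := by simp
  add_mem' := by
    intro p q hp hq i
    simp only [mem_ofPred_eq] at hp hq
    simp [hp i, hq i, mul_add]
  smul_mem' := by
    intro c p hp i
    simp only [mem_ofPred_eq] at hp
    simp only [Prod.smul_snd, Prod.smul_fst, inner_smul_right, hp i]
    ring

theorem mem_diagonalGraph {e : HilbertBasis ι ℂ H} {lam : ι → ℝ} {p : H × H} :
    p ∈ diagonalGraph e lam ↔ ∀ i, ⟪e i, p.2⟫_ℂ = lam i * ⟪e i, p.1⟫_ℂ := Iff.rfl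

theorem isClosed_diagonalGraph (e : HilbertBasis ι ℂ H) (lam : ι → ℝ) :
    IsClosed (diagonalGraph e lam : Set (H × H)) := by
  have : (diagonalGraph e lam : Set (H × H)) =
      ⋂ i, {p | ⟪e i, p.2⟫_ℂ = lam i * ⟪e i, p.1⟫_ℂ} := by
    ext p; simp [mem_diagonalGraph]
  rw [this]
  exact isClosed_iInter fun i => isClosed_eq (by fun_prop) (by fun_prop)

/-- A symmetric operator that has an orthonormal eigenbasis in its domain is essentially
self-adjoint: its closure is the maximal diagonal operator. -/
theorem closure_span_eq_diagonalGraph (e : HilbertBasis ι ℂ H) (lam : ι → ℝ) {G : Set (H × H)}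
    (hmem : ∀ i, (e i, (lam i : ℂ) • e i) ∈ G)
    (hsymm : ∀ p ∈ G, ∀ i, ⟪e i, p.2⟫_ℂ = lam i * ⟪e i, p.1⟫_ℂ) :
    (Submodule.span ℂ G).topologicalClosure = diagonalGraph e lam := by
  apply le_antisymm
  · exact Submodule.topologicalClosure_minimal _ (Submodule.span_le.2 hsymm)
      (isClosed_diagonalGraph e lam)
  · intro p hp
    -- Expand both components of `p` over the same finite index sets: each partial sum is a
    -- combination of eigenpairs, because the coefficients of `p.2` are `lam i` times those of
    -- `p.1`.
    have h := (e.hasSum_repr p.1).prodMk (e.hasSum_repr p.2)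
    refine mem_closure_of_tendsto h (Filter.Eventually.of_forall fun s => ?_)
    refine Submodule.sum_mem _ fun i _ => ?_
    have : (e.repr p.1 i • e i, e.repr p.2 i • e i) =
        (e.repr p.1 i) • ((e i, (lam i : ℂ) • e i) : H × H) := by
      rw [Prod.smul_mk, smul_smul, e.repr_apply_apply, e.repr_apply_apply, hp i, mul_comm]
    rw [this]
    exact Submodule.smul_mem _ _ (Submodule.subset_span (hmem i))

/-- A bounded diagonal operator in an orthonormal basis. -/
theorem exists_diagonal_clm (e : HilbertBasis ι ℂ H) (c : ι → ℂ) (C : ℝ) (hc : ∀ i, ‖c i‖ ≤ C) :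
    ∃ R : H →L[ℂ] H, ∀ f i, ⟪e i, R f⟫_ℂ = c i * ⟪e i, f⟫_ℂ := by
  rcases isEmpty_or_nonempty ι with hι | ⟨⟨i₀⟩⟩
  · exact ⟨0, fun f i => hι.elim i⟩
  have hC : 0 ≤ C := (norm_nonneg _).trans (hc i₀)
  have hmem : ∀ x : lp (fun _ : ι => ℂ) 2, Memℓp (fun i => c i * x i) 2 := fun x =>
    ((lp.memℓp x).const_smul (C : ℂ)).mono' fun i => by
      simp only [Pi.smul_apply, smul_eq_mul, norm_mul, Complex.norm_real, Real.norm_of_nonneg hC]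
      gcongr
      exact hc i
  let L : lp (fun _ : ι => ℂ) 2 →ₗ[ℂ] lp (fun _ : ι => ℂ) 2 :=
    { toFun := fun x => ⟨fun i => c i * x i, hmem x⟩
      map_add' := fun x y => by ext i; exact mul_add _ _ _
      map_smul' := fun s x => by ext i; exact mul_left_comm _ _ _ }
  have hL : ∀ x, ‖L x‖ ≤ C * ‖x‖ := fun x => by
    calc ‖L x‖ ≤ ‖(C : ℂ) • x‖ := by
          refine lp.norm_mono (by simp) fun i => ?_
          change ‖c i * x i‖ ≤ ‖(C : ℂ) * x i‖
          rw [norm_mul, norm_mul, Complex.norm_real, Real.norm_of_nonneg hC]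
          gcongr
          exact hc i
      _ = C * ‖x‖ := by rw [norm_smul, Complex.norm_real, Real.norm_of_nonneg hC]
  refine ⟨(e.repr.symm.toContinuousLinearEquiv : lp (fun _ : ι => ℂ) 2 →L[ℂ] H) ∘L (L.mkContinuous C hL) ∘L
    (e.repr.toContinuousLinearEquiv : H →L[ℂ] lp (fun _ : ι => ℂ) 2), fun f i => ?_⟩
  rw [← e.repr_apply_apply, ← e.repr_apply_apply]
  simp [L]

theorem eq_of_forall_inner_eq (e : HilbertBasis ι ℂ H) {u v : H}
    (h : ∀ i, ⟪e i, u⟫_ℂ = ⟪e i, v⟫_ℂ) : u = v := by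
  apply e.repr.injective
  ext i
  simpa only [e.repr_apply_apply] using h i

/-- An index with `lam i` within distance 1 of `z` has `lam i ≤ ‖z‖ + 1`, so there are finitely many
of these and the smallest distance is attained. -/
theorem exists_pos_le_norm_sub {lam : ι → ℝ} (hfin : ∀ R : ℝ, {i | lam i ≤ R}.Finite) {z : ℂ}
    (hz : ∀ i, (lam i : ℂ) ≠ z) : ∃ δ > 0, ∀ i, δ ≤ ‖(lam i : ℂ) - z‖ := by
  set F := (hfin (‖z‖ + 1)).toFinset
  have hsub : ∀ i, ‖(lam i : ℂ) - z‖ < 1 → i ∈ F := fun i hi => by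
    have h1 : lam i ≤ ‖(lam i : ℂ)‖ := by rw [Complex.norm_real]; exact le_abs_self _
    have h2 : ‖(lam i : ℂ)‖ ≤ ‖(lam i : ℂ) - z‖ + ‖z‖ := by
      simpa using norm_add_le ((lam i : ℂ) - z) z
    simp only [F, Finite.mem_toFinset, mem_ofPred_eq]
    linarith
  rcases F.eq_empty_or_nonempty with hF | hF
  · refine ⟨1, one_pos, fun i => le_of_not_gt fun hi => ?_⟩
    simpa [hF] using hsub i hi
  · obtain ⟨i₀, -, h₀⟩ := F.exists_min_image (fun i => ‖(lam i : ℂ) - z‖) hF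
    refine ⟨min 1 ‖(lam i₀ : ℂ) - z‖, lt_min one_pos (norm_pos_iff.2 (sub_ne_zero.2 (hz i₀))),
      fun i => ?_⟩
    by_cases hi : ‖(lam i : ℂ) - z‖ < 1
    · exact (min_le_right _ _).trans (h₀ i (hsub i hi))
    · exact (min_le_left _ _).trans (not_lt.1 hi)

theorem inner_eq_ite (e : HilbertBasis ι ℂ H) [DecidableEq ι] (i j : ι) :
    ⟪e i, e j⟫_ℂ = if i = j then 1 else 0 :=
  orthonormal_iff_ite.1 e.orthonormal i j

theorem basis_mem_diagonalGraph (e : HilbertBasis ι ℂ H) (lam : ι → ℝ) (i : ι) :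
    (e i, (lam i : ℂ) • e i) ∈ diagonalGraph e lam := by
  classical
  intro j
  rw [inner_smul_right, inner_eq_ite]
  split_ifs with h
  · rw [h]
  · simp

/-- Off the eigenvalues the resolvent is diagonal with entries `(lam i - z)⁻¹`, bounded since `z`
keeps a positive distance from all `lam i`. At an eigenvalue a left inverse would kill the
eigenvector. -/
theorem graphSpectrum_diagonalGraph (e : HilbertBasis ι ℂ H) {lam : ι → ℝ}
    (hfin : ∀ R : ℝ, {i | lam i ≤ R}.Finite) :
    graphSpectrum (diagonalGraph e lam) = {z : ℂ | ∃ i, z = lam i} := by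
  ext z
  simp only [graphSpectrum, mem_ofPred_eq]
  constructor
  · intro h
    by_contra! hz
    obtain ⟨δ, hδ, hle⟩ := exists_pos_le_norm_sub hfin fun i => (hz i).symm
    have hne : ∀ i, (lam i : ℂ) - z ≠ 0 := fun i => sub_ne_zero.2 (hz i).symm
    obtain ⟨R, hR⟩ := exists_diagonal_clm e (fun i => ((lam i : ℂ) - z)⁻¹) δ⁻¹ fun i => by
      rw [norm_inv]
      gcongr
      exact hle i
    refine h ⟨R, fun f i => ?_, fun u f huf => eq_of_forall_inner_eq e fun i => ?_⟩
    · simp only [inner_add_right, inner_smul_right, hR]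
      have := hne i
      field_simp
      ring
    · have h1 : ⟪e i, f⟫_ℂ = lam i * ⟪e i, u⟫_ℂ := huf i
      rw [hR, inner_sub_right, inner_smul_right, h1, ← sub_mul, inv_mul_cancel_left₀ (hne i)]
  · rintro ⟨i, rfl⟩ ⟨R, -, hR⟩
    have h0 := hR _ _ (basis_mem_diagonalGraph e lam i)
    rw [sub_self, map_zero] at h0
    exact e.orthonormal.ne_zero i h0.symm

/-- Coefficients of an eigenvector vanish wherever `lam i ≠ x`; finiteness of the remaining index
set makes the algebraic span sufficient, without closure. -/
theorem graphEigenspace_diagonalGraph (e : HilbertBasis ι ℂ H) (lam : ι → ℝ) (x : ℝ)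
    (hfin : {i | lam i = x}.Finite) :
    graphEigenspace (diagonalGraph e lam) x = Submodule.span ℂ (e '' {i | lam i = x}) := by
  have hmem : ∀ u, u ∈ graphEigenspace (diagonalGraph e lam) x ↔
      ∀ i, (x : ℂ) * ⟪e i, u⟫_ℂ = lam i * ⟪e i, u⟫_ℂ := fun u => by
    simp [graphEigenspace, mem_diagonalGraph]
  apply le_antisymm
  · intro u hu
    rw [hmem] at hu
    have hsum : u = ∑ i ∈ hfin.toFinset, e.repr u i • e i := by
      refine (e.hasSum_repr u).unique (hasSum_sum_of_ne_finset_zero fun i hi => ?_)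
      have hi' : lam i ≠ x := by simpa using hi
      have : ((x : ℂ) - lam i) * ⟪e i, u⟫_ℂ = 0 := by rw [sub_mul, hu i, sub_self]
      rcases mul_eq_zero.1 this with h | h
      · exact absurd (by exact_mod_cast (sub_eq_zero.1 h).symm) hi'
      · rw [e.repr_apply_apply, h, zero_smul]
    rw [hsum]
    exact Submodule.sum_mem _ fun i hi => Submodule.smul_mem _ _
      (Submodule.subset_span ⟨i, by simpa using hi, rfl⟩)
  · rw [Submodule.span_le]
    rintro _ ⟨i, hi, rfl⟩
    rw [SetLike.mem_coe, hmem]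
    intro j
    have := basis_mem_diagonalGraph e lam i j
    rw [inner_smul_right, show lam i = x from hi] at this
    exact this

theorem finrank_graphEigenspace_diagonalGraph (e : HilbertBasis ι ℂ H) (lam : ι → ℝ) (x : ℝ)
    (hfin : {i | lam i = x}.Finite) :
    FiniteDimensional ℂ (graphEigenspace (diagonalGraph e lam) x) ∧
      Module.finrank ℂ (graphEigenspace (diagonalGraph e lam) x) = {i | lam i = x}.ncard := by
  rw [graphEigenspace_diagonalGraph e lam x hfin]
  have := hfin.to_subtype
  refine ⟨FiniteDimensional.span_of_finite ℂ (hfin.image _), ?_⟩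
  have hli : LinearIndependent ℂ fun i : {i | lam i = x} => e i :=
    e.orthonormal.linearIndependent.comp _ Subtype.val_injective
  have := Fintype.ofFinite {i | lam i = x}
  have h := finrank_span_eq_card hli
  rw [image_eq_range, h, ← Nat.card_eq_fintype_card, Nat.card_coe_set_eq]

end DiagonalOperators

end WittenModel

namespace WittenModel

/-! ### Gaussians of positive definite forms are Schwartz functions. -/

section Gaussian

universe u

variable {E F : Type u} [NormedAddCommGroup E] [NormedSpace ℝ E]
  [NormedAddCommGroup F] [NormedSpace ℝ F]

theorem hasTemperateGrowth_fderiv {f : E → F} (hf : f.HasTemperateGrowth) :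
    (fderiv ℝ f).HasTemperateGrowth := by
  refine ⟨hf.1.fderiv_right (by simp), fun n => ?_⟩
  obtain ⟨k, C, h⟩ := hf.2 (n + 1)
  exact ⟨k, C, fun x => by rw [norm_iteratedFDeriv_fderiv]; exact h x⟩

theorem exists_pow_mul_exp_neg_le (N : ℕ) {c : ℝ} (hc : 0 < c) :
    ∃ M : ℝ, 0 ≤ M ∧ ∀ t : ℝ, 0 ≤ t → (1 + t) ^ N * Real.exp (-(1 / 2) * (c * t ^ 2)) ≤ M := by
  -- The constant comes from `(1 + t)^N ≤ N! e^{1 + t}` and, completing the square, `t - c t² / 2 ≤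
  -- 1 / (2 c)`.
  refine ⟨N.factorial * Real.exp (1 + 1 / (2 * c)), by positivity, fun t ht => ?_⟩
  have h1 : (1 + t) ^ N ≤ N.factorial * Real.exp (1 + t) := by
    have := Real.pow_div_factorial_le_exp (1 + t) (by positivity) N
    rwa [div_le_iff₀ (by positivity), mul_comm] at this
  calc (1 + t) ^ N * Real.exp (-(1 / 2) * (c * t ^ 2))
      ≤ N.factorial * Real.exp (1 + t) * Real.exp (-(1 / 2) * (c * t ^ 2)) := by gcongr
    _ = N.factorial * Real.exp (1 + t + -(1 / 2) * (c * t ^ 2)) := by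
      rw [Real.exp_add (1 + t), mul_assoc]
    _ ≤ _ := by
      refine mul_le_mul_of_nonneg_left (Real.exp_le_exp.2 ?_) (by positivity)
      have h2 : 1 / (2 * c) - (t + -(1 / 2) * (c * t ^ 2)) = (c * t - 1) ^ 2 / (2 * c) := by
        field_simp
        ring
      have h3 : 0 ≤ (c * t - 1) ^ 2 / (2 * c) := by positivity
      linarith

/-- The Gaussian `e^{-B(x, x) / 2}`. -/
noncomputable def gaussian (B : E →L[ℝ] E →L[ℝ] ℝ) (x : E) : ℝ := Real.exp (-(1 / 2) * B x x)

theorem hasFDerivAt_gaussian {B : E →L[ℝ] E →L[ℝ] ℝ} (hB : ∀ x y, B x y = B y x) (x : E) :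
    HasFDerivAt (gaussian B) (gaussian B x • -B x) x := by
  have h : HasFDerivAt (fun y => B y y) ((2 : ℝ) • B x) x := by
    refine (B.hasFDerivAt.clm_apply (hasFDerivAt_id x)).congr_fderiv ?_
    ext v
    simp [hB v x]
    ring
  refine ((h.const_mul (-(1 / 2))).exp).congr_fderiv ?_
  ext v
  simp [gaussian]

theorem contDiff_gaussian (B : E →L[ℝ] E →L[ℝ] ℝ) : ContDiff ℝ ∞ (gaussian B) :=
  (contDiff_const.mul (B.contDiff.clm_apply contDiff_id)).exp

/-- Differentiating a Gaussian times a function of temperate growth gives the Gaussian times another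
such function, so derivatives of every order reduce to order zero, where the Gaussian beats any
polynomial. -/
theorem gaussian_smul_decay {B : E →L[ℝ] E →L[ℝ] ℝ} (hB : ∀ x y, B x y = B y x) {c : ℝ}
    (hc : 0 < c) (hpos : ∀ x, c * ‖x‖ ^ 2 ≤ B x x) (k n : ℕ) {f : E → F}
    (hf : f.HasTemperateGrowth) :
    ∃ C, ∀ x, ‖x‖ ^ k * ‖iteratedFDeriv ℝ n (fun x => gaussian B x • f x) x‖ ≤ C := by
  -- The derivative takes values in `E →L[ℝ] F`, so the induction must range over all target spaces;
  -- for this `E` and `F` share one universe.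
  induction n generalizing F with
  | zero =>
    obtain ⟨N, A, hA⟩ := hf.2 0
    obtain ⟨M, hM0, hM⟩ := exists_pow_mul_exp_neg_le (k + N) hc
    have hA0 : 0 ≤ A := by
      have := (norm_nonneg _).trans (hA 0)
      simpa using this
    refine ⟨A * M, fun x => ?_⟩
    have h1 : ‖f x‖ ≤ A * (1 + ‖x‖) ^ N := by simpa using hA x
    have h2 : gaussian B x ≤ Real.exp (-(1 / 2) * (c * ‖x‖ ^ 2)) :=
      Real.exp_le_exp.2 (by linarith [hpos x])
    rw [norm_iteratedFDeriv_zero, norm_smul, gaussian, Real.norm_of_nonneg (Real.exp_nonneg _),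
      ← gaussian]
    calc ‖x‖ ^ k * (gaussian B x * ‖f x‖)
        ≤ (1 + ‖x‖) ^ k * (Real.exp (-(1 / 2) * (c * ‖x‖ ^ 2)) * (A * (1 + ‖x‖) ^ N)) := by
          have h3 : 0 ≤ gaussian B x := Real.exp_nonneg _
          gcongr
          linarith
      _ = A * ((1 + ‖x‖) ^ (k + N) * Real.exp (-(1 / 2) * (c * ‖x‖ ^ 2))) := by ring
      _ ≤ A * M := by gcongr; exact hM _ (norm_nonneg x)
  | succ n ih =>
    have hd : fderiv ℝ (fun x => gaussian B x • f x) =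
        fun x => gaussian B x • (fderiv ℝ f x + (-B x).smulRight (f x)) := by
      ext1 x
      have hfx : HasFDerivAt f (fderiv ℝ f x) x :=
        ((hf.1.differentiable (by simp)) x).hasFDerivAt
      rw [((hasFDerivAt_gaussian hB x).fun_smul hfx).fderiv]
      ext v
      simp [mul_smul]
    have hg : (fun x => fderiv ℝ f x + (-B x).smulRight (f x)).HasTemperateGrowth := by
      refine (hasTemperateGrowth_fderiv hf).add ?_
      exact (ContinuousLinearMap.smulRightL ℝ E F).bilinear_hasTemperateGrowth (𝕜 := ℝ)
        (-B).hasTemperateGrowth hf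
    obtain ⟨C, hC⟩ := ih hg
    refine ⟨C, fun x => ?_⟩
    rw [← norm_iteratedFDeriv_fderiv, hd]
    exact hC x

/-- The Gaussian `e^{-B(x, x) / 2}` of a positive definite form as a Schwartz function. -/
noncomputable def gaussianSchwartz (B : E →L[ℝ] E →L[ℝ] ℝ) (hB : ∀ x y, B x y = B y x)
    (hpos : ∃ c > 0, ∀ x, c * ‖x‖ ^ 2 ≤ B x x) (w : F) : 𝓢(E, F) where
  toFun := fun x => gaussian B x • w
  smooth' := (contDiff_gaussian B).smul contDiff_const
  decay' := fun k n => by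
    obtain ⟨c, hc, hpos⟩ := hpos
    exact gaussian_smul_decay hB hc hpos k n (.const w)

end Gaussian

end WittenModel

namespace WittenModel

/-! ### Multiplication, differentiation and the `L²` product on Schwartz functions. -/

section SchwartzOperators

open scoped LineDeriv ComplexConjugate

variable {E : Type*} [NormedAddCommGroup E] [NormedSpace ℝ E]

/-- Multiplication of complex valued Schwartz functions by a real linear functional. -/
noncomputable def mulOp (w : E →L[ℝ] ℂ) : Module.End ℂ 𝓢(E, ℂ) :=
  (SchwartzMap.smulLeftCLM ℂ (w : E → ℂ) : 𝓢(E, ℂ) →L[ℂ] 𝓢(E, ℂ)).toLinearMap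

/-- The directional derivative of complex valued Schwartz functions. -/
noncomputable def derivOp (v : E) : Module.End ℂ 𝓢(E, ℂ) :=
  (LineDeriv.lineDerivOpCLM ℂ 𝓢(E, ℂ) v : 𝓢(E, ℂ) →L[ℂ] 𝓢(E, ℂ)).toLinearMap

@[simp]
theorem mulOp_apply (w : E →L[ℝ] ℂ) (u : 𝓢(E, ℂ)) (z : E) : mulOp w u z = w z * u z := by
  simp [mulOp, SchwartzMap.smulLeftCLM_apply_apply w.hasTemperateGrowth]

theorem derivOp_apply (v : E) (u : 𝓢(E, ℂ)) (z : E) : derivOp v u z = fderiv ℝ u z v := by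
  simp [derivOp, SchwartzMap.lineDerivOp_apply_eq_fderiv]

theorem mulOp_mul_comm (w w' : E →L[ℝ] ℂ) : mulOp w * mulOp w' = mulOp w' * mulOp w := by
  ext u z
  simp only [Module.End.mul_apply, mulOp_apply]
  ring

theorem derivOp_mul_comm (v v' : E) : derivOp v * derivOp v' = derivOp v' * derivOp v := by
  ext u z
  have key : ∀ a b : E, (derivOp a * derivOp b) u z = fderiv ℝ (fderiv ℝ u) z a b := fun a b => by
    have hd : DifferentiableAt ℝ (fderiv ℝ u) z :=
      ((u.smooth 2).fderiv_right (m := 1) (by norm_num)).differentiable (by norm_num) z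
    rw [Module.End.mul_apply, derivOp_apply]
    have : (derivOp b u : E → ℂ) = fun y => fderiv ℝ u y b := funext (derivOp_apply b u)
    rw [this, fderiv_clm_apply hd (differentiableAt_const b)]
    simp
  rw [key, key]
  have := ((u.smooth 2).contDiffAt (x := z)).isSymmSndFDerivAt (by simp)
  exact this v v'

/-- The canonical commutation relation, from which the whole ladder algebra follows. -/
theorem derivOp_mul_mulOp (v : E) (w : E →L[ℝ] ℂ) :
    derivOp v * mulOp w = mulOp w * derivOp v + w v • (1 : Module.End ℂ 𝓢(E, ℂ)) := by
  ext u z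
  have h : (mulOp w u : E → ℂ) = ⇑w * ⇑u := funext (mulOp_apply w u)
  simp only [Module.End.mul_apply, LinearMap.add_apply, LinearMap.smul_apply,
    Module.End.one_apply, add_apply, smul_apply, mulOp_apply,
    derivOp_apply]
  rw [h, ((w.hasFDerivAt (x := z)).mul (u.hasFDerivAt z)).fderiv]
  simp
  ring

theorem derivOp_add (v v' : E) : derivOp (v + v') = derivOp v + derivOp v' := by
  ext u z
  simp [derivOp_apply]

theorem derivOp_smul (c : ℝ) (v : E) : derivOp (c • v) = (c : ℂ) • derivOp v := by
  ext u z
  simp [derivOp_apply]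

variable [FiniteDimensional ℝ E] [MeasureSpace E] [BorelSpace E]
  [(volume : Measure E).IsAddHaarMeasure]

/-- The `L²` inner product of Schwartz functions. -/
noncomputable def innerL2 (u v : 𝓢(E, ℂ)) : ℂ := ⟪u.toLp 2 volume, v.toLp 2 volume⟫_ℂ

theorem innerL2_eq_integral (u v : 𝓢(E, ℂ)) : innerL2 u v = ∫ z, conj (u z) * v z := by
  simp [innerL2, mul_comm]

theorem toLp_eq_toLpCLM (u : 𝓢(E, ℂ)) :
    u.toLp 2 volume = SchwartzMap.toLpCLM ℂ ℂ 2 volume u := rfl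

theorem innerL2_add_left (u u' v : 𝓢(E, ℂ)) :
    innerL2 (u + u') v = innerL2 u v + innerL2 u' v := by
  simp [innerL2, toLp_eq_toLpCLM, inner_add_left, -SchwartzMap.toLpCLM_apply]

theorem innerL2_add_right (u v v' : 𝓢(E, ℂ)) :
    innerL2 u (v + v') = innerL2 u v + innerL2 u v' := by
  simp [innerL2, toLp_eq_toLpCLM, inner_add_right, -SchwartzMap.toLpCLM_apply]

theorem innerL2_smul_left (c : ℂ) (u v : 𝓢(E, ℂ)) :
    innerL2 (c • u) v = conj c * innerL2 u v := by
  simp [innerL2, toLp_eq_toLpCLM, inner_smul_left, -SchwartzMap.toLpCLM_apply]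

theorem innerL2_smul_right (c : ℂ) (u v : 𝓢(E, ℂ)) :
    innerL2 u (c • v) = c * innerL2 u v := by
  simp [innerL2, toLp_eq_toLpCLM, inner_smul_right, -SchwartzMap.toLpCLM_apply]

theorem innerL2_conj_symm (u v : 𝓢(E, ℂ)) : conj (innerL2 u v) = innerL2 v u :=
  inner_conj_symm _ _

theorem innerL2_self_eq_zero {u : 𝓢(E, ℂ)} : innerL2 u u = 0 ↔ u = 0 := by
  rw [innerL2, inner_self_eq_zero]
  have h0 : (0 : 𝓢(E, ℂ)).toLp 2 volume = 0 := by
    rw [toLp_eq_toLpCLM, map_zero]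
  rw [← h0, (SchwartzMap.injective_toLp 2 volume).eq_iff]

theorem innerL2_mulOp {w w' : E →L[ℝ] ℂ} (h : ∀ z, w' z = conj (w z)) (u v : 𝓢(E, ℂ)) :
    innerL2 (mulOp w u) v = innerL2 u (mulOp w' v) := by
  simp only [innerL2_eq_integral, mulOp_apply, map_mul, h]
  congr 1 with z
  ring

/-- Integration by parts; the decay of Schwartz functions removes boundary terms. -/
theorem innerL2_derivOp (x : E) (u v : 𝓢(E, ℂ)) :
    innerL2 (derivOp x u) v = -innerL2 u (derivOp x v) := by
  have h := SchwartzMap.integral_bilinear_lineDerivOp_right_eq_neg_left (μ := volume) u v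
    ((ContinuousLinearMap.mul ℝ ℂ).comp (Complex.conjCLE : ℂ →L[ℝ] ℂ)) x
  simp only [innerL2_eq_integral]
  rw [eq_neg_iff_add_eq_zero, add_comm, ← eq_neg_iff_add_eq_zero]
  exact h

end SchwartzOperators

end WittenModel

namespace WittenModel

/-! ### Creation and annihilation operators in complex coordinates. -/

section Ladder

open scoped ComplexConjugate

variable {n : ℕ}

/-- The coordinate functionals: `(l, 0)` gives `z_l` and `(l, 1)` gives its conjugate. -/
noncomputable def coordFun (i : Fin n × Fin 2) : Tangent n →L[ℝ] ℂ :=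
  (if i.2 = 0 then ContinuousLinearMap.id ℝ ℂ else (Complex.conjCLE : ℂ →L[ℝ] ℂ)).comp
    ((EuclideanSpace.proj i.1 : Tangent n →L[ℂ] ℂ).restrictScalars ℝ)

/-- The index of the conjugate coordinate. -/
def flip (i : Fin n × Fin 2) : Fin n × Fin 2 := (i.1, 1 - i.2)

/-- The sign `σ = ± i` for which `z_l` or its conjugate is `x_l + σ y_l`. -/
noncomputable def coordSign (i : Fin n × Fin 2) : ℂ := if i.2 = 0 then Complex.I else -Complex.I

@[simp]
theorem coordFun_zero (l : Fin n) (z : Tangent n) : coordFun (l, 0) z = z l := by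
  simp [coordFun]

@[simp]
theorem coordFun_one (l : Fin n) (z : Tangent n) : coordFun (l, 1) z = conj (z l) := by
  simp [coordFun]

theorem flip_flip (i : Fin n × Fin 2) : flip (flip i) = i := by
  rcases i with ⟨l, s⟩
  simp [flip]

theorem flip_zero (l : Fin n) : flip (l, 0) = (l, 1) := rfl

theorem flip_one (l : Fin n) : flip (l, 1) = (l, 0) := rfl

theorem flip_fst (i : Fin n × Fin 2) : (flip i).1 = i.1 := rfl

theorem coordFun_flip (i : Fin n × Fin 2) (z : Tangent n) :
    coordFun (flip i) z = conj (coordFun i z) := by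
  rcases i with ⟨l, s⟩
  fin_cases s <;> simp [flip]

theorem coordSign_flip (i : Fin n × Fin 2) : coordSign (flip i) = conj (coordSign i) := by
  rcases i with ⟨l, s⟩
  fin_cases s <;> simp [flip, coordSign]

/-- The derivation `∂_{x_l} + σ ∂_{y_l}`. -/
noncomputable def wirtinger (i : Fin n × Fin 2) : Module.End ℂ 𝓢(Tangent n, ℂ) :=
  derivOp (realBasis (i.1, 0)) + coordSign i • derivOp (realBasis (i.1, 1))

theorem coordFun_realBasis (i : Fin n × Fin 2) (p : Fin n × Fin 2) :
    coordFun i (realBasis p) =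
      if i.1 = p.1 then (if p.2 = 0 then 1 else coordSign i) else 0 := by
  rcases i with ⟨l, s⟩
  rcases p with ⟨l', s'⟩
  by_cases h : l = l'
  · subst h
    fin_cases s <;> fin_cases s' <;> simp [realBasis, coordSign]
  · fin_cases s <;> fin_cases s' <;> simp [realBasis, h]

/-- The scalar is `(∂_x + σ_i ∂_y)(x + σ_j y)`: it is 0 for equal signs, because `σ² = -1`, and 2
for opposite signs. -/
theorem wirtinger_mul_mulOp (i j : Fin n × Fin 2) :
    wirtinger i * mulOp (coordFun j) = mulOp (coordFun j) * wirtinger i +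
      (if i.1 = j.1 then 1 + coordSign i * coordSign j else 0) •
        (1 : Module.End ℂ 𝓢(Tangent n, ℂ)) := by
  have h : (if i.1 = j.1 then 1 + coordSign i * coordSign j else 0 : ℂ) =
      coordFun j (realBasis (i.1, 0)) + coordSign i * coordFun j (realBasis (i.1, 1)) := by
    simp only [coordFun_realBasis, eq_comm (a := j.1)]
    split_ifs <;> simp_all
  rw [h, wirtinger, add_mul, smul_mul_assoc, derivOp_mul_mulOp, derivOp_mul_mulOp, mul_add,
    mul_smul_comm]
  module

theorem wirtinger_mul_comm (i j : Fin n × Fin 2) :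
    wirtinger i * wirtinger j = wirtinger j * wirtinger i := by
  simp only [wirtinger, add_mul, mul_add, smul_mul_assoc, mul_smul_comm]
  rw [derivOp_mul_comm (realBasis (i.1, 0)) (realBasis (j.1, 0)),
    derivOp_mul_comm (realBasis (i.1, 1)) (realBasis (j.1, 0)),
    derivOp_mul_comm (realBasis (i.1, 0)) (realBasis (j.1, 1)),
    derivOp_mul_comm (realBasis (i.1, 1)) (realBasis (j.1, 1))]
  module

variable (κ : Fin n → ℝ)

/-- The creation operators of the harmonic oscillator with frequencies `κ`. -/
noncomputable def creation (i : Fin n × Fin 2) : Module.End ℂ 𝓢(Tangent n, ℂ) :=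
  (κ i.1 : ℂ) • mulOp (coordFun i) - wirtinger i

/-- The annihilation operators of the harmonic oscillator with frequencies `κ`. -/
noncomputable def annihilation (i : Fin n × Fin 2) : Module.End ℂ 𝓢(Tangent n, ℂ) :=
  (κ i.1 : ℂ) • mulOp (coordFun (flip i)) + wirtinger (flip i)

/-- The two cross commutators carry the same constant `1 + σ_i σ_j` and the same frequency with
opposite signs, so they cancel. -/
theorem creation_mul_comm (i j : Fin n × Fin 2) : Commute (creation κ i) (creation κ j) := by
  simp only [Commute, SemiconjBy, creation, sub_mul, mul_sub, smul_mul_assoc, mul_smul_comm]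
  rw [wirtinger_mul_mulOp i j, wirtinger_mul_mulOp j i, wirtinger_mul_comm i j,
    mulOp_mul_comm (coordFun i) (coordFun j)]
  by_cases h : i.1 = j.1
  · simp only [h, if_true, mul_comm (coordSign j)]
    module
  · simp only [h, Ne.symm h, if_false]
    module

/-- Here the two cross commutators add instead of cancelling; each contributes `κ (1 + σ_{flip i}
σ_j)`, which is `2 κ` for `i = j` and 0 for conjugate indices. -/
theorem annihilation_mul_creation (i j : Fin n × Fin 2) :
    annihilation κ i * creation κ j = creation κ j * annihilation κ i +
      (if i = j then 4 * (κ i.1 : ℂ) else 0) • (1 : Module.End ℂ 𝓢(Tangent n, ℂ)) := by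
  simp only [annihilation, creation, sub_mul, mul_sub, add_mul, mul_add, smul_mul_assoc,
    mul_smul_comm]
  rw [wirtinger_mul_mulOp (flip i) j, wirtinger_mul_mulOp j (flip i),
    wirtinger_mul_comm j (flip i), mulOp_mul_comm (coordFun (flip i)) (coordFun j)]
  simp only [flip_fst]
  by_cases h : i.1 = j.1
  · have hij : (if i = j then 4 * (κ i.1 : ℂ) else 0) =
        κ i.1 * (2 * (1 + coordSign (flip i) * coordSign j)) := by
      rcases i with ⟨l, s⟩
      rcases j with ⟨l', t⟩
      obtain rfl : l = l' := h
      fin_cases s <;> fin_cases t <;> simp [coordSign, flip] <;> ring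
    rw [hij]
    simp only [h, if_true, mul_comm (coordSign j)]
    module
  · have hij : i ≠ j := fun e => h (by rw [e])
    simp only [h, Ne.symm h, hij, if_false]
    module

theorem innerL2_wirtinger (i : Fin n × Fin 2) (u v : 𝓢(Tangent n, ℂ)) :
    innerL2 (wirtinger i u) v = -innerL2 u (wirtinger (flip i) v) := by
  simp only [wirtinger, LinearMap.add_apply, LinearMap.smul_apply, innerL2_add_left,
    innerL2_add_right, innerL2_smul_left, innerL2_smul_right, innerL2_derivOp, coordSign_flip,
    flip_fst]
  ring

theorem innerL2_creation (i : Fin n × Fin 2) (u v : 𝓢(Tangent n, ℂ)) :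
    innerL2 (creation κ i u) v = innerL2 u (annihilation κ i v) := by
  have h : creation κ i u = (κ i.1 : ℂ) • mulOp (coordFun i) u + (-1 : ℂ) • wirtinger i u := by
    simp [creation, sub_eq_add_neg]
  rw [h, annihilation, LinearMap.add_apply, LinearMap.smul_apply, innerL2_add_left,
    innerL2_add_right, innerL2_smul_left, innerL2_smul_right, innerL2_smul_left,
    innerL2_mulOp (coordFun_flip i), innerL2_wirtinger]
  simp

theorem innerL2_annihilation (i : Fin n × Fin 2) (u v : 𝓢(Tangent n, ℂ)) :
    innerL2 (annihilation κ i u) v = innerL2 u (creation κ i v) := by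
  rw [← innerL2_conj_symm, ← innerL2_creation, innerL2_conj_symm]

/-- The number operators `(a†a)_{(l,0)} + (a†a)_{(l,1)}` recover the two dimensional oscillator. -/
theorem creation_mul_annihilation_add (l : Fin n) :
    creation κ (l, 0) * annihilation κ (l, 0) + creation κ (l, 1) * annihilation κ (l, 1) =
      (2 : ℂ) • (-(derivOp (realBasis (l, 0)) * derivOp (realBasis (l, 0))) -
        derivOp (realBasis (l, 1)) * derivOp (realBasis (l, 1)) +
        ((κ l : ℂ) ^ 2) • (mulOp (coordFun (l, 0)) * mulOp (coordFun (l, 1)))) -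
      (4 * κ l : ℂ) • (1 : Module.End ℂ 𝓢(Tangent n, ℂ)) := by
  have hw : wirtinger (l, 0) * wirtinger (l, 1) =
      derivOp (realBasis (l, 0)) * derivOp (realBasis (l, 0)) +
        derivOp (realBasis (l, 1)) * derivOp (realBasis (l, 1)) := by
    simp only [wirtinger, coordSign, add_mul, mul_add, smul_mul_assoc, mul_smul_comm,
      derivOp_mul_comm (realBasis (l, 1)) (realBasis (l, 0)), if_true, one_ne_zero, if_false,
      smul_add, smul_smul]
    rw [show -Complex.I * Complex.I = 1 by simp]
    module
  have h01 : wirtinger (l, 0) * mulOp (coordFun (l, 1)) =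
      mulOp (coordFun (l, 1)) * wirtinger (l, 0) +
        (2 : ℂ) • (1 : Module.End ℂ 𝓢(Tangent n, ℂ)) := by
    rw [wirtinger_mul_mulOp]
    simp [coordSign, one_add_one_eq_two]
  have h10 : wirtinger (l, 1) * mulOp (coordFun (l, 0)) =
      mulOp (coordFun (l, 0)) * wirtinger (l, 1) +
        (2 : ℂ) • (1 : Module.End ℂ 𝓢(Tangent n, ℂ)) := by
    rw [wirtinger_mul_mulOp]
    simp [coordSign, one_add_one_eq_two]
  simp only [annihilation, creation, sub_mul, mul_add, smul_mul_assoc,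
    mul_smul_comm, flip_zero, flip_one]
  rw [h01, h10, wirtinger_mul_comm (l, 1) (l, 0), hw, mulOp_mul_comm (coordFun (l, 1))]
  module

end Ladder

end WittenModel

namespace WittenModel

/-! ### Eigenfunctions of the scalar oscillator, indexed by occupation numbers. -/

theorem pi_nat_induction {I : Type*} [Fintype I] [DecidableEq I] {P : (I → ℕ) → Prop}
    (h0 : P 0) (hs : ∀ α i, P α → P (α + Pi.single i 1)) (α : I → ℕ) : P α := by
  induction hN : ∑ i, α i generalizing α with
  | zero =>
    have : α = 0 := funext fun i => by simpa using (Finset.sum_eq_zero_iff.1 hN) i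
    rwa [this]
  | succ N ih =>
    obtain ⟨i, hi⟩ : ∃ i, α i ≠ 0 := by
      by_contra! h
      simp [h] at hN
    have hα : α - Pi.single i 1 + Pi.single i 1 = α := by
      funext j
      by_cases h : j = i
      · subst h
        simp
        omega
      · simp [h]
    rw [← hα]
    refine hs _ _ (ih _ ?_)
    have := congrArg (fun β => ∑ j, β j) hα
    simp [Finset.sum_add_distrib] at this
    simp only [Pi.sub_apply]
    omega

section States

open scoped ComplexConjugate

variable {n : ℕ} (κ : Fin n → ℝ)

/-- The quadratic form `∑ κ_l |z_l|²`. -/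
noncomputable def oscillatorForm : Tangent n →L[ℝ] Tangent n →L[ℝ] ℝ :=
  ∑ l, κ l • (innerSL ℝ (E := ℂ)).bilinearComp
    ((EuclideanSpace.proj l : Tangent n →L[ℂ] ℂ).restrictScalars ℝ)
    ((EuclideanSpace.proj l : Tangent n →L[ℂ] ℂ).restrictScalars ℝ)

theorem oscillatorForm_apply (z w : Tangent n) :
    oscillatorForm κ z w = ∑ l, κ l * ⟪z l, w l⟫_ℝ := by
  simp [oscillatorForm]

theorem oscillatorForm_symm (z w : Tangent n) : oscillatorForm κ z w = oscillatorForm κ w z := by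
  simp only [oscillatorForm_apply, real_inner_comm]

theorem oscillatorForm_pos {κ : Fin n → ℝ} (hκ : ∀ l, 0 < κ l) :
    ∃ c > 0, ∀ z, c * ‖z‖ ^ 2 ≤ oscillatorForm κ z z := by
  obtain ⟨c, hc, hle⟩ : ∃ c > 0, ∀ l, c ≤ κ l := by
    rcases isEmpty_or_nonempty (Fin n) with h | h
    · exact ⟨1, one_pos, fun l => h.elim l⟩
    · obtain ⟨l, hl⟩ := Finite.exists_min κ
      exact ⟨κ l, hκ l, hl⟩
  refine ⟨c, hc, fun z => ?_⟩
  rw [oscillatorForm_apply, EuclideanSpace.norm_sq_eq, Finset.mul_sum]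
  refine Finset.sum_le_sum fun l _ => ?_
  rw [real_inner_self_eq_norm_sq]
  gcongr
  exact hle l

variable {κ} (hκ : ∀ l, 0 < κ l)

/-- The ground state `e^{-∑ κ_l |z_l|² / 2}` of the harmonic oscillator. -/
noncomputable def groundState : 𝓢(Tangent n, ℂ) :=
  gaussianSchwartz (oscillatorForm κ) (oscillatorForm_symm κ) (oscillatorForm_pos hκ) 1

theorem groundState_apply (z : Tangent n) :
    groundState hκ z = (gaussian (oscillatorForm κ) z : ℂ) := by
  change gaussian (oscillatorForm κ) z • (1 : ℂ) = _
  simp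

theorem gaussian_pos (z : Tangent n) : 0 < gaussian (oscillatorForm κ) z := Real.exp_pos _

theorem groundState_ne_zero : groundState hκ ≠ 0 := fun h => by
  have h1 := groundState_apply hκ 0
  rw [h] at h1
  have h2 : (gaussian (oscillatorForm κ) 0 : ℂ) ≠ 0 := by
    exact_mod_cast (gaussian_pos (κ := κ) 0).ne'
  exact h2 (by simpa using h1.symm)

theorem derivOp_groundState (v z : Tangent n) :
    derivOp v (groundState hκ) z = -(oscillatorForm κ z v : ℂ) * groundState hκ z := by
  have h : (groundState hκ : Tangent n → ℂ) = fun y => gaussian (oscillatorForm κ) y • (1 : ℂ) :=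
    rfl
  rw [derivOp_apply, h,
    ((hasFDerivAt_gaussian (oscillatorForm_symm κ) z).smul_const (1 : ℂ)).fderiv]
  simp
  ring

theorem oscillatorForm_realBasis (z : Tangent n) (l : Fin n) :
    oscillatorForm κ z (realBasis (l, 0)) = κ l * (z l).re ∧
      oscillatorForm κ z (realBasis (l, 1)) = κ l * (z l).im := by
  constructor <;> rw [oscillatorForm_apply, Finset.sum_eq_single l] <;>
    simp +contextual [realBasis, Complex.inner]

/-- On the Gaussian a derivation `∂_x + σ ∂_y` acts as multiplication by `-κ (x + σ y)`, which
cancels the multiplication term. -/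
theorem annihilation_groundState (i : Fin n × Fin 2) :
    annihilation κ i (groundState hκ) = 0 := by
  ext z
  simp only [annihilation, wirtinger, LinearMap.add_apply, LinearMap.smul_apply, add_apply,
    smul_apply, mulOp_apply, derivOp_groundState, flip_fst, oscillatorForm_realBasis]
  rcases i with ⟨l, s⟩
  have hz := Complex.re_add_im (z l)
  have hz' : conj (z l) = (z l).re - (z l).im * Complex.I := by
    apply Complex.ext <;> simp
  fin_cases s
  · simp [flip, coordSign, hz']
    ring
  · simp [flip, coordSign]
    linear_combination (-(κ l) * groundState hκ z : ℂ) * hz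

/-- This makes the product of powers of creation operators independent of any ordering of the modes,
so that raising one occupation number is applying one more operator. -/
theorem pairwise_commute_creation (κ : Fin n → ℝ) :
    Pairwise fun i j : Fin n × Fin 2 => ∀ x y : Multiplicative ℕ,
      Commute (powersHom (Module.End ℂ 𝓢(Tangent n, ℂ)) (creation κ i) x)
        (powersHom (Module.End ℂ 𝓢(Tangent n, ℂ)) (creation κ j) y) := fun i j _ _ _ => by
  simpa [powersHom_apply] using (creation_mul_comm κ i j).pow_pow _ _

/-- The eigenfunctions of the harmonic oscillator, indexed by their occupation numbers. -/
noncomputable def state (α : Fin n × Fin 2 → ℕ) : 𝓢(Tangent n, ℂ) :=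
  MonoidHom.noncommPiCoprod (fun i => powersHom (Module.End ℂ 𝓢(Tangent n, ℂ)) (creation κ i))
    (pairwise_commute_creation κ)
    (fun i => Multiplicative.ofAdd (α i)) (groundState hκ)

theorem state_zero : state hκ 0 = groundState hκ := by
  have : (fun i : Fin n × Fin 2 => Multiplicative.ofAdd ((0 : Fin n × Fin 2 → ℕ) i)) = 1 := rfl
  rw [state, this, map_one, Module.End.one_apply]

theorem state_add_single (α : Fin n × Fin 2 → ℕ) (i : Fin n × Fin 2) :
    state hκ (α + Pi.single i 1) = creation κ i (state hκ α) := by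
  have : (fun j : Fin n × Fin 2 => Multiplicative.ofAdd ((α + Pi.single i 1 : Fin n × Fin 2 → ℕ) j)) =
      Pi.mulSingle i (Multiplicative.ofAdd 1) * fun j => Multiplicative.ofAdd (α j) := by
    funext j
    by_cases h : j = i
    · subst h
      simp [ofAdd_add, mul_comm]
    · simp [h]
  rw [state, this, map_mul, MonoidHom.noncommPiCoprod_mulSingle, Module.End.mul_apply]
  simp [state, powersHom_apply]

/-- Moving the annihilation operator to the right, it picks up `4 κ` at each creation operator of
its own mode and finally kills the ground state. -/
theorem annihilation_state (i : Fin n × Fin 2) (α : Fin n × Fin 2 → ℕ) :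
    annihilation κ i (state hκ α) = (4 * κ i.1 * α i : ℂ) • state hκ (α - Pi.single i 1) := by
  induction α using pi_nat_induction with
  | h0 => simp [state_zero, annihilation_groundState]
  | hs α j ih =>
    rw [state_add_single, ← Module.End.mul_apply, annihilation_mul_creation, LinearMap.add_apply,
      Module.End.mul_apply, ih, map_smul, ← state_add_single]
    by_cases h : i = j
    · subst h
      have h1 : α + Pi.single i 1 - Pi.single i 1 = α := by ext; simp
      -- For `α i = 0` the truncated subtraction does not undo the addition, but the coefficient of
      -- that term is zero.
      rcases Nat.eq_zero_or_pos (α i) with h0 | h0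
      · simp [h0, h1]
      · have h2 : α - Pi.single i 1 + Pi.single i 1 = α := by
          funext k
          by_cases hk : k = i
          · subst hk
            simp
            omega
          · simp [hk]
        rw [h1, h2]
        simp
        module
    · have h2 : α - Pi.single i 1 + Pi.single j 1 = α + Pi.single j 1 - Pi.single i 1 := by
        funext k
        by_cases hk : k = i
        · subst hk
          simp [h]
        · simp [hk]
      simp [h, h2]

theorem creation_annihilation_state (i : Fin n × Fin 2) (α : Fin n × Fin 2 → ℕ) :
    creation κ i (annihilation κ i (state hκ α)) = (4 * κ i.1 * α i : ℂ) • state hκ α := by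
  rw [annihilation_state, map_smul, ← state_add_single]
  rcases Nat.eq_zero_or_pos (α i) with h0 | h0
  · simp [h0]
  · congr 2
    funext k
    by_cases hk : k = i
    · subst hk
      simp
      omega
    · simp [hk]

/-- Annihilation brings a raised state back to a nonzero multiple of the lower one, so raising
cannot produce zero. -/
theorem state_ne_zero (α : Fin n × Fin 2 → ℕ) : state hκ α ≠ 0 := by
  induction α using pi_nat_induction with
  | h0 => rw [state_zero]; exact groundState_ne_zero hκ
  | hs α i ih =>
    intro h
    have h1 := annihilation_state hκ i (α + Pi.single i 1)
    have h2 : α + Pi.single i 1 - Pi.single i 1 = α := by ext; simp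
    rw [h, map_zero, h2, eq_comm, smul_eq_zero] at h1
    rcases h1 with h1 | h1
    · have := (hκ i.1).ne'
      have h3 : (α i : ℂ) + 1 ≠ 0 := Nat.cast_add_one_ne_zero (α i)
      simp [this, h3] at h1
    · exact ih h1

/-- Symmetry of the number operator, against an arbitrary Schwartz function. It gives both the
orthogonality of states and the identity needed to identify the closure. -/
theorem innerL2_state_creation_annihilation (α : Fin n × Fin 2 → ℕ) (i : Fin n × Fin 2)
    (u : 𝓢(Tangent n, ℂ)) :
    innerL2 (state hκ α) (creation κ i (annihilation κ i u)) =
      (4 * κ i.1 * α i : ℂ) * innerL2 (state hκ α) u := by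
  rw [← innerL2_annihilation, ← innerL2_creation, creation_annihilation_state, innerL2_smul_left]
  simp [map_ofNat]

/-- Some number operator is symmetric with different eigenvalues on the two states. -/
theorem innerL2_state_of_ne {α β : Fin n × Fin 2 → ℕ} (h : α ≠ β) :
    innerL2 (state hκ α) (state hκ β) = 0 := by
  obtain ⟨i, hi⟩ := Function.ne_iff.1 h
  have h1 := innerL2_state_creation_annihilation hκ α i (state hκ β)
  rw [creation_annihilation_state, innerL2_smul_right, ← sub_eq_zero, ← sub_mul] at h1
  refine (mul_eq_zero.1 h1).resolve_left fun h2 => hi ?_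
  have h3 : (κ i.1 : ℂ) ≠ 0 := by exact_mod_cast (hκ i.1).ne'
  have h4 : (4 * κ i.1 : ℂ) * ((β i : ℂ) - α i) = 0 := by rw [← h2]; ring
  have h5 := (mul_eq_zero.1 h4).resolve_left (by simp [h3])
  exact_mod_cast (sub_eq_zero.1 h5).symm

variable (κ)

/-- The scalar harmonic oscillator `-Δ + ∑ κ_l² |z_l|²`. -/
noncomputable def oscillator : Module.End ℂ 𝓢(Tangent n, ℂ) :=
  ∑ l, (-(derivOp (realBasis (l, 0)) * derivOp (realBasis (l, 0))) -
        derivOp (realBasis (l, 1)) * derivOp (realBasis (l, 1)) +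
        ((κ l : ℂ) ^ 2) • (mulOp (coordFun (l, 0)) * mulOp (coordFun (l, 1))))

theorem oscillator_eq : oscillator κ = ∑ l, ((1 / 2 : ℂ) •
    (creation κ (l, 0) * annihilation κ (l, 0) + creation κ (l, 1) * annihilation κ (l, 1)) +
      (2 * κ l : ℂ) • (1 : Module.End ℂ 𝓢(Tangent n, ℂ))) := by
  refine Finset.sum_congr rfl fun l _ => ?_
  rw [creation_mul_annihilation_add]
  module

variable {κ}

/-- The energy of a state with occupation numbers `α`. -/
noncomputable def energy (κ : Fin n → ℝ) (α : Fin n × Fin 2 → ℕ) : ℝ :=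
  ∑ l, 2 * κ l * (α (l, 0) + α (l, 1) + 1)

theorem oscillator_state (α : Fin n × Fin 2 → ℕ) :
    oscillator κ (state hκ α) = (energy κ α : ℂ) • state hκ α := by
  simp only [oscillator_eq, LinearMap.sum_apply, LinearMap.add_apply, LinearMap.smul_apply,
    Module.End.mul_apply, Module.End.one_apply, creation_annihilation_state, energy,
    Complex.ofReal_sum, Finset.sum_smul]
  refine Finset.sum_congr rfl fun l _ => ?_
  push_cast
  module

theorem innerL2_sum_right {E ι : Type*} [NormedAddCommGroup E] [NormedSpace ℝ E]
    [FiniteDimensional ℝ E] [MeasureSpace E] [BorelSpace E] [(volume : Measure E).IsAddHaarMeasure]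
    (s : Finset ι) (u : 𝓢(E, ℂ)) (v : ι → 𝓢(E, ℂ)) :
    innerL2 u (∑ i ∈ s, v i) = ∑ i ∈ s, innerL2 u (v i) := by
  simp [innerL2, toLp_eq_toLpCLM, inner_sum, -SchwartzMap.toLpCLM_apply]

theorem innerL2_state_oscillator (α : Fin n × Fin 2 → ℕ) (u : 𝓢(Tangent n, ℂ)) :
    innerL2 (state hκ α) (oscillator κ u) = energy κ α * innerL2 (state hκ α) u := by
  simp only [oscillator_eq, LinearMap.sum_apply, LinearMap.add_apply, LinearMap.smul_apply,
    Module.End.mul_apply, Module.End.one_apply, energy, Complex.ofReal_sum, Finset.sum_mul,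
    innerL2_sum_right, innerL2_add_right, innerL2_smul_right, innerL2_state_creation_annihilation]
  refine Finset.sum_congr rfl fun l _ => ?_
  push_cast
  ring

end States

end WittenModel

namespace WittenModel

/-! ### A square integrable function with vanishing Gaussian moments is zero. -/

section Fourier

open scoped FourierTransform ComplexConjugate

variable {V : Type} [NormedAddCommGroup V] [InnerProductSpace ℝ V] [FiniteDimensional ℝ V]
  [MeasurableSpace V] [BorelSpace V]

/-- Every test function is the Fourier transform of a Schwartz function, and the transform can be
moved to the other factor of the integral, where it vanishes. -/
theorem ae_eq_zero_of_fourier_eq_zero {g : V → ℂ} (hg : Integrable g) (h : ∀ ξ, 𝓕 g ξ = 0) :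
    ∀ᵐ x, g x = 0 := by
  refine ae_eq_zero_of_integral_contDiff_smul_eq_zero hg.locallyIntegrable fun η hη hc => ?_
  have hc' : HasCompactSupport fun x => (η x : ℂ) := hc.comp_left (g := Complex.ofReal) rfl
  let ψ : 𝓢(V, ℂ) := hc'.toSchwartzMap (Complex.ofRealCLM.contDiff.comp hη)
  have h1 := VectorFourier.integral_fourierIntegral_smul_eq_flip (μ := volume) (ν := volume)
    (L := innerₗ V) Real.continuous_fourierChar continuous_inner (𝓕⁻ ψ).integrable hg
  have h2 : ∀ x, VectorFourier.fourierIntegral Real.fourierChar volume (innerₗ V).flip g x = 0 :=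
    fun x => by rw [flip_innerₗ]; exact h x
  have h3 : ∀ x, VectorFourier.fourierIntegral Real.fourierChar volume (innerₗ V)
      (𝓕⁻ ψ : 𝓢(V, ℂ)) x = η x := fun x => by
    have h4 : (𝓕 (𝓕⁻ ψ) : 𝓢(V, ℂ)) x = ψ x := by rw [FourierTransform.fourier_fourierInv_eq]
    exact h4
  simp only [h2, h3, smul_zero, integral_zero] at h1
  simpa using h1

/-- A square integrable function all of whose moments against a Gaussian vanish is zero. -/
theorem ae_eq_zero_of_gaussian_moments {B : V →L[ℝ] V →L[ℝ] ℝ} (hB : ∀ x y, B x y = B y x)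
    {c : ℝ} (hc : 0 < c) (hpos : ∀ x, c * ‖x‖ ^ 2 ≤ B x x) {f : V → ℂ} (hf : MemLp f 2)
    (h : ∀ (ξ : V) (k : ℕ), ∫ x, ((⟪x, ξ⟫_ℝ : ℂ) ^ k * gaussian B x) * f x = 0) :
    f =ᵐ[volume] 0 := by
  have hpos' : ∀ x, c / 2 * ‖x‖ ^ 2 ≤ ((1 / 2 : ℝ) • B) x x := fun x => by
    have := hpos x
    simp
    linarith
  have hB' : ∀ x y, ((1 / 2 : ℝ) • B) x y = ((1 / 2 : ℝ) • B) y x := fun x y => by simp [hB x y]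
  have hγ : MemLp (gaussian ((1 / 2 : ℝ) • B)) 2 (volume : Measure V) := by
    have h1 := (gaussianSchwartz (F := ℝ) _ hB' ⟨c / 2, by positivity, hpos'⟩ 1).memLp 2
      (volume : Measure V)
    refine h1.ae_eq (Filter.Eventually.of_forall fun x => ?_)
    change gaussian _ x • (1 : ℝ) = _
    simp
  -- Half of the exponent absorbs the exponential, with `C t - c t² / 4 ≤ C² / c` by completing the
  -- square; the other half is an `L²` function to be paired with `f`.
  have hexp : ∀ C : ℝ, 0 ≤ C → ∀ x, Real.exp (C * ‖x‖) * gaussian B x ≤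
      Real.exp (C ^ 2 / c) * gaussian ((1 / 2 : ℝ) • B) x := fun C hC x => by
    rw [gaussian, gaussian, ← Real.exp_add, ← Real.exp_add, Real.exp_le_exp]
    have h1 : C ^ 2 / c - C * ‖x‖ + c / 4 * ‖x‖ ^ 2 = (2 * C - c * ‖x‖) ^ 2 / (4 * c) := by
      field_simp
      ring
    have h2 : 0 ≤ (2 * C - c * ‖x‖) ^ 2 / (4 * c) := by positivity
    have h3 := hpos x
    simp
    linarith
  have hint : ∀ C : ℝ, 0 ≤ C → Integrable fun x => Real.exp (C * ‖x‖) * (gaussian B x * ‖f x‖) :=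
    fun C hC => by
      refine ((hγ.integrable_mul hf.norm).const_mul (Real.exp (C ^ 2 / c))).mono' ?_ ?_
      · exact (Continuous.aestronglyMeasurable (by fun_prop)).mul
          ((contDiff_gaussian B).continuous.aestronglyMeasurable.mul hf.1.norm)
      · refine Filter.Eventually.of_forall fun x => ?_
        have h0 : 0 ≤ gaussian B x := Real.exp_nonneg _
        rw [Real.norm_of_nonneg (by positivity), ← mul_assoc, Pi.mul_apply, ← mul_assoc]
        exact mul_le_mul_of_nonneg_right (hexp C hC x) (norm_nonneg _)
  have hg : Integrable fun x => (gaussian B x : ℂ) * f x := by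
    refine (hint 0 le_rfl).mono' ?_ ?_
    · exact (Complex.continuous_ofReal.comp
        (contDiff_gaussian B).continuous).aestronglyMeasurable.mul hf.1
    · refine Filter.Eventually.of_forall fun x => ?_
      simp [abs_of_nonneg (show 0 ≤ gaussian B x from Real.exp_nonneg _)]
  -- Expand the character in its exponential series and integrate term by term, dominated by
  -- `e^{2π‖ξ‖‖x‖}` times the Gaussian and `‖f‖`. Every term is a multiple of a moment.
  have hzero : ∀ ξ, 𝓕 (fun x => (gaussian B x : ℂ) * f x) ξ = 0 := fun ξ => by
    rw [Real.fourier_eq']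
    have key : HasSum (fun k : ℕ => ∫ x, ((-2 * Real.pi * ⟪x, ξ⟫_ℝ : ℝ) * Complex.I) ^ k /
        (k.factorial : ℂ) * ((gaussian B x : ℂ) * f x))
        (∫ x, Complex.exp ((-2 * Real.pi * ⟪x, ξ⟫_ℝ : ℝ) * Complex.I) •
          ((gaussian B x : ℂ) * f x)) := by
      have hsum : ∀ x, HasSum (fun k : ℕ => (2 * Real.pi * ‖ξ‖ * ‖x‖) ^ k / k.factorial *
          (gaussian B x * ‖f x‖)) (Real.exp (2 * Real.pi * ‖ξ‖ * ‖x‖) *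
          (gaussian B x * ‖f x‖)) := fun x => by
        have := NormedSpace.expSeries_div_hasSum_exp (2 * Real.pi * ‖ξ‖ * ‖x‖)
        rw [← Real.exp_eq_exp_ℝ] at this
        exact this.mul_right _
      refine hasSum_integral_of_dominated_convergence
        (fun k x => (2 * Real.pi * ‖ξ‖ * ‖x‖) ^ k / k.factorial * (gaussian B x * ‖f x‖))
        (fun k => ?_) (fun k => ?_) ?_ ?_ ?_
      · refine (Continuous.aestronglyMeasurable ?_).mul hg.1
        fun_prop
      · refine Filter.Eventually.of_forall fun x => ?_
        have h0 : 0 ≤ gaussian B x := Real.exp_nonneg _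
        simp only [norm_mul, norm_div, norm_pow, Complex.norm_I, mul_one, Complex.norm_real,
          Real.norm_of_nonneg h0, RCLike.norm_natCast]
        have h1 : ‖⟪x, ξ⟫_ℝ‖ ≤ ‖ξ‖ * ‖x‖ := by
          rw [mul_comm]
          exact norm_inner_le_norm x ξ
        have h2 : ‖(-2 : ℝ)‖ * ‖Real.pi‖ * ‖⟪x, ξ⟫_ℝ‖ ≤ 2 * Real.pi * ‖ξ‖ * ‖x‖ := by
          rw [Real.norm_of_nonneg Real.pi_pos.le, norm_neg, mul_assoc (2 * Real.pi)]
          simp only [Real.norm_ofNat]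
          gcongr
        gcongr
      · exact Filter.Eventually.of_forall fun x => (hsum x).summable
      · simp only [(hsum _).tsum_eq]
        exact hint _ (by positivity)
      · refine Filter.Eventually.of_forall fun x => ?_
        have := NormedSpace.expSeries_div_hasSum_exp
          (((-2 * Real.pi * ⟪x, ξ⟫_ℝ : ℝ) : ℂ) * Complex.I)
        rw [← Complex.exp_eq_exp_ℂ] at this
        exact this.mul_right _
    have hz : ∀ k : ℕ, ∫ x, ((-2 * Real.pi * ⟪x, ξ⟫_ℝ : ℝ) * Complex.I) ^ k /
        (k.factorial : ℂ) * ((gaussian B x : ℂ) * f x) = 0 := fun k => by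
      have : ∀ x, ((-2 * Real.pi * ⟪x, ξ⟫_ℝ : ℝ) * Complex.I) ^ k /
          (k.factorial : ℂ) * ((gaussian B x : ℂ) * f x) =
          ((-2 * Real.pi * Complex.I) ^ k / (k.factorial : ℂ)) *
            (((⟪x, ξ⟫_ℝ : ℂ) ^ k * gaussian B x) * f x) := fun x => by
        push_cast
        ring
      simp only [this]
      rw [integral_const_mul, h ξ k, mul_zero]
    simp only [hz] at key
    exact (hasSum_zero.unique key).symm
  filter_upwards [ae_eq_zero_of_fourier_eq_zero hg hzero] with x hx
  have h0 : (gaussian B x : ℂ) ≠ 0 := by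
    have : gaussian B x ≠ 0 := (Real.exp_pos _).ne'
    exact_mod_cast this
  exact (mul_eq_zero.1 hx).resolve_left h0

end Fourier

end WittenModel

namespace WittenModel

/-! ### Completeness of the oscillator states. -/

section StatesComplete

open scoped ComplexConjugate

variable {n m : ℕ} {κ : Fin n → ℝ} (hκ : ∀ l, 0 < κ l)

theorem mulOp_coordFun_eq (i : Fin n × Fin 2) (h : κ i.1 ≠ 0) :
    mulOp (coordFun i) =
      (1 / (2 * κ i.1) : ℂ) • (creation κ i + annihilation κ (flip i)) := by
  have h' : (κ i.1 : ℂ) ≠ 0 := by exact_mod_cast h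
  have h2 : creation κ i + annihilation κ (flip i) = (2 * κ i.1 : ℂ) • mulOp (coordFun i) := by
    rw [creation, annihilation, flip_flip, flip_fst]
    module
  rw [h2, smul_smul, one_div_mul_cancel (by simpa using h'), one_smul]

/-- A coordinate is a combination of a creation and an annihilation operator. Hence the span of the
states contains every polynomial times the Gaussian, in particular the functions defining the
moments. -/
theorem mulOp_coordFun_mem_span (i : Fin n × Fin 2) {u : 𝓢(Tangent n, ℂ)}
    (hu : u ∈ Submodule.span ℂ (range (state hκ))) :
    mulOp (coordFun i) u ∈ Submodule.span ℂ (range (state hκ)) := by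
  have hle : Submodule.span ℂ (range (state hκ)) ≤
      (Submodule.span ℂ (range (state hκ))).comap (mulOp (coordFun i)) := by
    rw [Submodule.span_le]
    rintro _ ⟨α, rfl⟩
    rw [SetLike.mem_coe, Submodule.mem_comap, mulOp_coordFun_eq i (hκ i.1).ne',
      LinearMap.smul_apply, LinearMap.add_apply, ← state_add_single, annihilation_state]
    exact Submodule.smul_mem _ _ (Submodule.add_mem _ (Submodule.subset_span ⟨_, rfl⟩)
      (Submodule.smul_mem _ _ (Submodule.subset_span ⟨_, rfl⟩)))
  exact hle hu

/-- The functional `z ↦ ⟪z, ξ⟫`. -/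
noncomputable def innerFun (ξ : Tangent n) : Tangent n →L[ℝ] ℂ :=
  Complex.ofRealCLM.comp ((innerSL ℝ).flip ξ)

theorem innerFun_apply (ξ z : Tangent n) : innerFun ξ z = (⟪z, ξ⟫_ℝ : ℂ) := by
  rfl

theorem mulOp_innerFun (ξ : Tangent n) : mulOp (innerFun ξ) =
    ∑ l, ((1 / 2 * conj (ξ l)) • mulOp (coordFun (l, 0)) +
      (1 / 2 * ξ l) • mulOp (coordFun (l, 1))) := by
  ext u z
  simp only [mulOp_apply, LinearMap.sum_apply, LinearMap.add_apply, LinearMap.smul_apply,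
    sum_apply, add_apply, smul_apply, coordFun_zero, coordFun_one, innerFun_apply,
    PiLp.inner_apply, Complex.ofReal_sum, Finset.sum_mul, smul_eq_mul]
  refine Finset.sum_congr rfl fun l _ => ?_
  have : ((⟪z l, ξ l⟫_ℝ : ℝ) : ℂ) = 1 / 2 * conj (ξ l) * z l + 1 / 2 * ξ l * conj (z l) := by
    rw [Complex.inner]
    apply Complex.ext <;> simp <;> ring
  rw [this]
  ring

theorem mulOp_innerFun_pow_mem_span (ξ : Tangent n) (k : ℕ) :
    ((mulOp (innerFun ξ)) ^ k) (groundState hκ) ∈ Submodule.span ℂ (range (state hκ)) := by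
  induction k with
  | zero => exact Submodule.subset_span ⟨0, state_zero hκ⟩
  | succ k ih =>
    rw [pow_succ', Module.End.mul_apply, mulOp_innerFun]
    simp only [LinearMap.sum_apply, LinearMap.add_apply, LinearMap.smul_apply]
    exact Submodule.sum_mem _ fun l _ => Submodule.add_mem _
      (Submodule.smul_mem _ _ (mulOp_coordFun_mem_span hκ _ (mulOp_innerFun ξ ▸ ih)))
      (Submodule.smul_mem _ _ (mulOp_coordFun_mem_span hκ _ (mulOp_innerFun ξ ▸ ih)))

theorem mulOp_pow_apply (w : Tangent n →L[ℝ] ℂ) (k : ℕ) (u : 𝓢(Tangent n, ℂ)) (z : Tangent n) :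
    ((mulOp w) ^ k) u z = w z ^ k * u z := by
  induction k with
  | zero => simp
  | succ k ih =>
    rw [pow_succ', Module.End.mul_apply, mulOp_apply, ih]
    ring

/-- The states of the harmonic oscillator are complete. -/
theorem ae_eq_zero_of_integral_state_mul {f : Tangent n → ℂ} (hf : MemLp f 2)
    (h : ∀ α, ∫ z, conj (state hκ α z) * f z = 0) : f =ᵐ[volume] 0 := by
  have hspan : ∀ u ∈ Submodule.span ℂ (range (state hκ)), ∫ z, conj (u z) * f z = 0 := by
    intro u hu
    have hi : ∀ v : 𝓢(Tangent n, ℂ), Integrable fun z => conj (v z) * f z := fun v =>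
      ((v.memLp 2 volume).star).integrable_mul hf
    induction hu using Submodule.span_induction with
    | mem x hx =>
      obtain ⟨α, rfl⟩ := hx
      exact h α
    | zero => simp
    | add x y _ _ hx hy =>
      simp only [add_apply, map_add, add_mul]
      rw [integral_add (hi x) (hi y), hx, hy, add_zero]
    | smul c x _ hx =>
      simp only [smul_apply, smul_eq_mul, map_mul, mul_assoc]
      rw [integral_const_mul, hx, mul_zero]
  obtain ⟨c, hc, hpos⟩ := oscillatorForm_pos hκ
  refine ae_eq_zero_of_gaussian_moments (oscillatorForm_symm κ) hc hpos hf fun ξ k => ?_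
  rw [← hspan _ (mulOp_innerFun_pow_mem_span hκ ξ k)]
  congr 1 with z
  rw [mulOp_pow_apply, groundState_apply, innerFun_apply]
  simp

end StatesComplete

/-! ### The torus action on the states. -/

section Rotation

variable {n m : ℕ} {κ : Fin n → ℝ} (hκ : ∀ l, 0 < κ l) (k : Fin n → Fin m → ℤ) (θ : Fin m → ℝ)

/-- Pull back of Schwartz functions by the torus action. -/
noncomputable def pullback : 𝓢(Tangent n, ℂ) →L[ℂ] 𝓢(Tangent n, ℂ) :=
  SchwartzMap.compCLMOfContinuousLinearEquiv ℂ (torusIso k θ).toContinuousLinearEquiv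

theorem pullback_apply (u : 𝓢(Tangent n, ℂ)) (z : Tangent n) :
    pullback k θ u z = u (torusAct k θ z) := by
  rw [← torusIso_apply]
  rfl

/-- The character by which the torus acts on the coordinate `i`. -/
noncomputable def coordChar (i : Fin n × Fin 2) : ℂ :=
  Complex.exp (coordSign i * (pairing (k i.1) θ : ℝ))

theorem coordFun_torusAct (i : Fin n × Fin 2) (z : Tangent n) :
    coordFun i (torusAct k θ z) = coordChar k θ i * coordFun i z := by
  rcases i with ⟨l, s⟩
  fin_cases s
  · simp [torusAct, coordChar, coordSign]
  · simp [torusAct, coordChar, coordSign, ← Complex.exp_conj]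

theorem torusAct_realBasis (l : Fin n) :
    torusAct k θ (realBasis (l, 0)) = Real.cos (pairing (k l) θ) • realBasis (l, 0) +
        Real.sin (pairing (k l) θ) • realBasis (l, 1) ∧
      torusAct k θ (realBasis (l, 1)) = (-Real.sin (pairing (k l) θ)) • realBasis (l, 0) +
        Real.cos (pairing (k l) θ) • realBasis (l, 1) := by
  constructor <;> ext j <;> by_cases h : j = l
  · subst h
    simp only [torusAct, realBasis]
    rw [mul_comm Complex.I, Complex.exp_mul_I]
    simp
  · simp [torusAct, realBasis, h]
  · subst h
    simp only [torusAct, realBasis]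
    rw [mul_comm Complex.I, Complex.exp_mul_I]
    simp only [one_ne_zero, if_false, if_true, PiLp.add_apply, PiLp.smul_apply,
      PiLp.single_apply, Complex.real_smul]
    push_cast
    linear_combination (Complex.sin (pairing (k j) θ)) * Complex.I_mul_I
  · simp [torusAct, realBasis, h]

theorem pullback_derivOp (v : Tangent n) (u : 𝓢(Tangent n, ℂ)) :
    derivOp v (pullback k θ u) = pullback k θ (derivOp (torusAct k θ v) u) := by
  rw [← torusIso_apply]
  exact SchwartzMap.lineDerivOp_compCLMOfContinuousLinearEquiv ℂ v _ u

/-- The derivation `∂_x + σ ∂_y` acquires the same character as the coordinate `x + σ y`, so both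
terms of a creation operator transform alike. -/
theorem wirtinger_pullback (i : Fin n × Fin 2) (u : 𝓢(Tangent n, ℂ)) :
    pullback k θ (wirtinger i u) = coordChar k θ i • wirtinger i (pullback k θ u) := by
  have hc : coordChar k θ i = Real.cos (pairing (k i.1) θ) +
      coordSign i * Real.sin (pairing (k i.1) θ) := by
    rcases i with ⟨l, s⟩
    fin_cases s
    · have hs : coordSign ((l, 0) : Fin n × Fin 2) = Complex.I := rfl
      change Complex.exp (coordSign (l, 0) * _) = _ + coordSign (l, 0) * _
      rw [hs, mul_comm, Complex.exp_mul_I]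
      simp [mul_comm]
    · have hs : coordSign ((l, 1) : Fin n × Fin 2) = -Complex.I := rfl
      change Complex.exp (coordSign (l, 1) * _) = _ + coordSign (l, 1) * _
      rw [hs, neg_mul, mul_comm, ← neg_mul, Complex.exp_mul_I]
      simp [mul_comm]
  have hs : coordSign i * coordSign i = -1 := by
    rw [coordSign]; split_ifs <;> simp
  have hcs : (Real.cos (pairing (k i.1) θ) : ℂ) ^ 2 + (Real.sin (pairing (k i.1) θ) : ℂ) ^ 2 = 1 := by
    exact_mod_cast Real.cos_sq_add_sin_sq _
  obtain ⟨h0, h1⟩ := torusAct_realBasis k θ i.1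
  simp only [wirtinger, LinearMap.add_apply, LinearMap.smul_apply, pullback_derivOp, h0, h1,
    derivOp_add, derivOp_smul, Complex.ofReal_neg, map_add, map_smul, hc]
  set C := (Real.cos (pairing (k i.1) θ) : ℂ)
  set S := (Real.sin (pairing (k i.1) θ) : ℂ)
  set P := pullback k θ (derivOp (realBasis (i.1, 0)) u)
  set Q := pullback k θ (derivOp (realBasis (i.1, 1)) u)
  set σ := coordSign i
  -- With the character `C + σ S`, these two identities undo the rotation of the basis vectors; they
  -- use only `C² + S² = 1` and `σ² = -1`.
  have e1 : (C + σ * S) * (C - σ * S) = 1 := by linear_combination hcs - S ^ 2 * hs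
  have e2 : (C + σ * S) * (S + σ * C) = σ := by
    linear_combination σ * hcs + (C * S) * hs
  calc P + σ • Q = ((C + σ * S) * (C - σ * S)) • P + ((C + σ * S) * (S + σ * C)) • Q := by
        rw [e1, e2, one_smul]
    _ = _ := by
        module

theorem creation_pullback (i : Fin n × Fin 2) (u : 𝓢(Tangent n, ℂ)) :
    pullback k θ (creation κ i u) = coordChar k θ i • creation κ i (pullback k θ u) := by
  have hm : pullback k θ (mulOp (coordFun i) u) =
      coordChar k θ i • mulOp (coordFun i) (pullback k θ u) := by
    ext z
    simp only [pullback_apply, mulOp_apply, smul_apply, coordFun_torusAct, smul_eq_mul, mul_assoc]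
  simp only [creation, LinearMap.sub_apply, LinearMap.smul_apply, map_sub, map_smul, hm,
    wirtinger_pullback]
  module

theorem gaussian_torusAct (z : Tangent n) :
    gaussian (oscillatorForm κ) (torusAct k θ z) = gaussian (oscillatorForm κ) z := by
  have : ∀ l, ‖torusAct k θ z l‖ = ‖z l‖ := fun l => by
    simp [torusAct, Complex.norm_exp]
  simp only [gaussian, oscillatorForm_apply, real_inner_self_eq_norm_sq, this]

/-- The Gaussian is invariant, since the torus preserves each `|z_l|`, and every creation operator
contributes its character. -/
theorem pullback_state_eq_prod (α : Fin n × Fin 2 → ℕ) :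
    pullback k θ (state hκ α) = (∏ i, coordChar k θ i ^ α i) • state hκ α := by
  induction α using pi_nat_induction with
  | h0 =>
    ext z
    simp [state_zero, pullback_apply, groundState_apply, gaussian_torusAct]
  | hs α i ih =>
    rw [state_add_single, creation_pullback, ih, map_smul, smul_smul]
    congr 1
    have hi : ∏ j, coordChar k θ j ^ (Pi.single i 1 : Fin n × Fin 2 → ℕ) j = coordChar k θ i := by
      rw [Finset.prod_eq_single i] <;> simp +contextual
    simp only [Pi.add_apply, pow_add, Finset.prod_mul_distrib, hi, mul_comm]

/-- The weight of a state for the torus action with weights `k` on the base. -/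
def stateWeight (α : Fin n × Fin 2 → ℕ) : Fin m → ℤ :=
  ∑ h, ((α (h, 0) : ℤ) - α (h, 1)) • k h

theorem pairing_stateWeight (α : Fin n × Fin 2 → ℕ) :
    pairing (stateWeight k α) θ =
      ∑ h, ((α (h, 0) : ℝ) - α (h, 1)) * pairing (k h) θ := by
  simp only [pairing, stateWeight, Finset.sum_apply, Pi.smul_apply, smul_eq_mul, Int.cast_sum,
    Finset.sum_mul, Finset.mul_sum]
  rw [Finset.sum_comm]
  refine Finset.sum_congr rfl fun h _ => Finset.sum_congr rfl fun p _ => ?_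
  push_cast
  ring

theorem state_torusAct (α : Fin n × Fin 2 → ℕ) (z : Tangent n) :
    state hκ α (torusAct k θ z) =
      Complex.exp (Complex.I * (pairing (stateWeight k α) θ : ℝ)) * state hκ α z := by
  rw [← pullback_apply, pullback_state_eq_prod, smul_apply, smul_eq_mul, pairing_stateWeight]
  congr 1
  rw [Fintype.prod_prod_type, Complex.ofReal_sum, Finset.mul_sum, Complex.exp_sum]
  refine Finset.prod_congr rfl fun h _ => ?_
  rw [Fin.prod_univ_two, coordChar, coordChar, ← Complex.exp_nat_mul, ← Complex.exp_nat_mul,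
    ← Complex.exp_add]
  congr 1
  simp [coordSign]
  ring

end Rotation

end WittenModel

namespace WittenModel

open Filter Topology

/-! ### The real orthonormal basis of the tangent space. -/

section Basis

variable {n : ℕ}

theorem orthonormal_realBasis : Orthonormal ℝ (realBasis : Fin n × Fin 2 → Tangent n) := by
  rw [orthonormal_iff_ite]
  rintro ⟨l, s⟩ ⟨l', s'⟩
  rw [PiLp.inner_apply]
  by_cases h : l = l'
  · subst h
    rw [Finset.sum_eq_single l]
    · fin_cases s <;> fin_cases s' <;> simp [realBasis, Complex.inner]
    · intro b _ hb
      simp [realBasis, hb]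
    · simp
  · rw [if_neg fun e => h (congrArg Prod.fst e)]
    refine Finset.sum_eq_zero fun p _ => ?_
    by_cases hp : p = l
    · subst hp
      simp [realBasis, h]
    · simp [realBasis, hp]

theorem sum_realBasis (z : Tangent n) :
    z = ∑ l, ((z l).re • realBasis (l, 0) + (z l).im • realBasis (l, 1)) := by
  ext j
  rw [WithLp.ofLp_sum, Finset.sum_apply, Finset.sum_eq_single j]
  · simp [realBasis, Complex.re_add_im]
  · intro l _ hl
    simp [realBasis, hl.symm]
  · simp

/-- `realBasis` as an orthonormal basis. -/
noncomputable def realONB : OrthonormalBasis (Fin n × Fin 2) ℝ (Tangent n) :=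
  OrthonormalBasis.mk orthonormal_realBasis fun z _ => by
    rw [sum_realBasis z]
    exact Submodule.sum_mem _ fun l _ => Submodule.add_mem _
      (Submodule.smul_mem _ _ (Submodule.subset_span ⟨_, rfl⟩))
      (Submodule.smul_mem _ _ (Submodule.subset_span ⟨_, rfl⟩))

@[simp]
theorem realONB_apply (p : Fin n × Fin 2) : realONB p = (realBasis p : Tangent n) := by
  simp [realONB]

/-- The coordinates of a tangent vector in the real basis. -/
noncomputable def realCoord (z : Tangent n) (p : Fin n × Fin 2) : ℝ := realONB.repr z p

theorem sum_realCoord (z : Tangent n) : ∑ p, realCoord z p • realBasis p = z := by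
  have := realONB.sum_repr z
  simpa [realCoord] using this

end Basis

/-! ### The induced vector field and infinitesimal equivariance. -/

section InducedField

theorem hasDerivAt_euclidean_iff {N : ℕ} {f : ℝ → EuclideanSpace ℂ (Fin N)}
    {f' : EuclideanSpace ℂ (Fin N)} {t : ℝ} :
    HasDerivAt f f' t ↔ ∀ j, HasDerivAt (fun s => f s j) (f' j) t := by
  rw [hasDerivAt_iff_hasFDerivAt, ← hasFDerivWithinAt_univ, hasFDerivWithinAt_piLp 2]
  exact forall_congr' fun j => by
    rw [hasDerivAt_iff_hasFDerivAt, hasFDerivWithinAt_univ]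
    refine iff_of_eq ?_
    congr 1

variable {n m : ℕ} (k : Fin n → Fin m → ℤ) (τ : Fin m → ℝ)

theorem pairing_smul (w : Fin m → ℤ) (t : ℝ) : pairing w (t • τ) = t * pairing w τ := by
  simp only [pairing, Pi.smul_apply, smul_eq_mul, Finset.mul_sum]
  exact Finset.sum_congr rfl fun _ _ => by ring

theorem pairing_neg (w : Fin m → ℤ) : pairing w (-τ) = -pairing w τ := by
  simp [pairing]

theorem pairing_add_left (w w' : Fin m → ℤ) : pairing (w + w') τ = pairing w τ + pairing w' τ := by
  simp [pairing, add_mul, Finset.sum_add_distrib]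

/-- The vector field induced by `τ` as a linear map. -/
noncomputable def inducedCLM : Tangent n →L[ℝ] Tangent n :=
  LinearMap.toContinuousLinearMap
    { toFun := fun z => WithLp.toLp 2 fun l => Complex.I * pairing (k l) τ * z l
      map_add' := fun z w => by ext l; simp [mul_add]
      map_smul' := fun c z => by ext l; simp; ring }

@[simp]
theorem inducedCLM_apply (z : Tangent n) (l : Fin n) :
    inducedCLM k τ z l = Complex.I * pairing (k l) τ * z l := rfl

theorem hasDerivAt_torusAct (z : Tangent n) :
    HasDerivAt (fun t : ℝ => torusAct k (t • τ) z) (inducedCLM k τ z) 0 := by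
  rw [hasDerivAt_euclidean_iff]
  intro l
  have h1 : HasDerivAt (fun t : ℝ => Complex.I * ((t * pairing (k l) τ : ℝ) : ℂ))
      (Complex.I * pairing (k l) τ) 0 := by
    have h2 : HasDerivAt (fun t : ℝ => ((t * pairing (k l) τ : ℝ) : ℂ))
        (pairing (k l) τ : ℂ) 0 := by
      have := ((hasDerivAt_id (0 : ℝ)).mul_const (pairing (k l) τ)).ofReal_comp
      simpa using this
    exact h2.const_mul _
  have h3 := (h1.cexp).mul_const (z l)
  simp only [torusAct, pairing_smul]
  simpa using h3

theorem inducedField_eq : inducedField k τ = inducedCLM k τ :=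
  funext fun z => (hasDerivAt_torusAct k τ z).deriv

theorem inducedCLM_realBasis (l : Fin n) :
    inducedCLM k τ (realBasis (l, 0)) = pairing (k l) τ • realBasis (l, 1) ∧
      inducedCLM k τ (realBasis (l, 1)) = -(pairing (k l) τ • realBasis (l, 0)) := by
  constructor <;> ext j <;> by_cases h : j = l
  · subst h; simp [realBasis, mul_comm]
  · simp [realBasis, h]
  · subst h
    simp only [inducedCLM_apply, realBasis, PiLp.neg_apply, PiLp.smul_apply, PiLp.single_apply,
      if_true, one_ne_zero, if_false, Complex.real_smul]
    linear_combination (pairing (k j) τ : ℂ) * Complex.I_mul_I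
  · simp [realBasis, h]

theorem norm_sq_inducedCLM (z : Tangent n) :
    ⟪inducedCLM k τ z, inducedCLM k τ z⟫_ℝ = ∑ l, pairing (k l) τ ^ 2 * ‖z l‖ ^ 2 := by
  rw [real_inner_self_eq_norm_sq, EuclideanSpace.norm_sq_eq]
  refine Finset.sum_congr rfl fun l _ => ?_
  simp [mul_pow]

theorem torusAct_smul_real {N : ℕ} (w : Fin N → Fin m → ℤ) (θ : Fin m → ℝ) (s : ℝ)
    (z : EuclideanSpace ℂ (Fin N)) : torusAct w θ (s • z) = s • torusAct w θ z := by
  ext j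
  simp [torusAct, mul_left_comm]

/-- The equation that defines sections of type `ρ`, in components. -/
theorem torusAct_neg_eq_iff {r : ℕ} (a : Fin r → Fin m → ℤ) (b : Fin m → ℤ) (θ : Fin m → ℝ)
    (w w' : Fiber r) :
    torusAct a (-θ) w = Complex.exp (Complex.I * (pairing b θ : ℝ)) • w' ↔
      ∀ j, w j = Complex.exp (Complex.I * (pairing (a j) θ + pairing b θ : ℝ)) * w' j := by
  rw [← (WithLp.ofLp_injective 2).eq_iff, funext_iff]
  refine forall_congr' fun j => ?_
  have h : Complex.exp (Complex.I * (pairing (a j) θ : ℝ)) ≠ 0 := Complex.exp_ne_zero _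
  have h2 : torusAct a (-θ) w j = (Complex.exp (Complex.I * (pairing (a j) θ : ℝ)))⁻¹ * w j := by
    rw [← Complex.exp_neg]
    simp [torusAct, pairing_neg]
  rw [h2, inv_mul_eq_iff_eq_mul₀ h, PiLp.smul_apply, smul_eq_mul, ← mul_assoc, ← Complex.exp_add]
  push_cast
  rw [mul_add]

theorem isOfType_iff {r : ℕ} {a : Fin r → Fin m → ℤ} {b : Fin m → ℤ}
    {U : Set (Tangent n)} {u : Tangent n → Fiber r} :
    IsOfType k a b U u ↔ ∀ θ, ∀ x ∈ U, ∀ j, u (torusAct k θ x) j =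
      Complex.exp (Complex.I * (pairing (a j) θ + pairing b θ : ℝ)) * u x j :=
  forall_congr' fun θ => forall₂_congr fun _ _ => torusAct_neg_eq_iff a b θ _ _

variable {k τ} in
theorem IsOfType.apply_torusAct {r : ℕ} {a : Fin r → Fin m → ℤ} {b : Fin m → ℤ}
    {U : Set (Tangent n)} {u : Tangent n → Fiber r} (hu : IsOfType k a b U u) {x : Tangent n}
    (hx : x ∈ U) (θ : Fin m → ℝ) (j : Fin r) :
    u (torusAct k θ x) j = Complex.exp (Complex.I * (pairing (a j) θ + pairing b θ : ℝ)) * u x j :=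
  (isOfType_iff k).1 hu θ x hx j

/-- Infinitesimal version of equivariance. -/
theorem IsOfType.fderiv_inducedCLM {r : ℕ} {a : Fin r → Fin m → ℤ} {b : Fin m → ℤ}
    {U : Set (Tangent n)} {u : Tangent n → Fiber r} (hu : IsOfType k a b U u) {x : Tangent n}
    (hx : x ∈ U) (hd : DifferentiableAt ℝ u x) (j : Fin r) :
    fderiv ℝ u x (inducedCLM k τ x) j =
      Complex.I * (pairing (a j) τ + pairing b τ : ℝ) * u x j := by
  have h0 : torusAct k ((0 : ℝ) • τ) x = x := by
    ext l
    simp [torusAct, pairing]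
  have h1 : HasDerivAt (fun t : ℝ => u (torusAct k (t • τ) x))
      (fderiv ℝ u x (inducedCLM k τ x)) 0 := by
    have hd' : HasFDerivAt u (fderiv ℝ u x) (torusAct k ((0 : ℝ) • τ) x) := by
      rw [h0]; exact hd.hasFDerivAt
    exact hd'.comp_hasDerivAt 0 (hasDerivAt_torusAct k τ x)
  have h2 := (hasDerivAt_euclidean_iff.1 h1) j
  simp only [hu.apply_torusAct hx, pairing_smul] at h2
  have h3 : HasDerivAt (fun t : ℝ =>
      Complex.I * ((t * pairing (a j) τ + t * pairing b τ : ℝ) : ℂ))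
      (Complex.I * (pairing (a j) τ + pairing b τ : ℝ)) 0 := by
    have h4 : HasDerivAt (fun t : ℝ => ((t * pairing (a j) τ + t * pairing b τ : ℝ) : ℂ))
        ((pairing (a j) τ + pairing b τ : ℝ) : ℂ) 0 := by
      have := (((hasDerivAt_id (0 : ℝ)).mul_const (pairing (a j) τ)).add
        ((hasDerivAt_id (0 : ℝ)).mul_const (pairing b τ))).ofReal_comp
      simpa using this
    exact h4.const_mul _
  have h5 := (h3.cexp).mul_const (u x j)
  have h6 := h2.unique h5
  simpa using h6

end InducedField

end WittenModel

namespace WittenModel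

open Filter Topology

/-- Product rule at a point where the second factor vanishes; the first need only be continuous. -/
theorem hasFDerivAt_clm_apply_of_eq_zero {E F G : Type*} [NormedAddCommGroup E] [NormedSpace ℝ E]
    [NormedAddCommGroup F] [NormedSpace ℝ F] [NormedAddCommGroup G] [NormedSpace ℝ G]
    {Φ : E → F →L[ℝ] G} {h : E → F} {h' : E →L[ℝ] F} {x : E} (hΦ : ContinuousAt Φ x)
    (hx : h x = 0) (hh : HasFDerivAt h h' x) :
    HasFDerivAt (fun y => Φ y (h y)) (Φ x ∘L h') x := by
  rw [hasFDerivAt_iff_isLittleO] at hh ⊢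
  have h1 : (fun y => Φ y (h y - h x - h' (y - x))) =o[𝓝 x] fun y => y - x := by
    have hb : (fun y => Φ y) =O[𝓝 x] fun _ => (1 : ℝ) := hΦ.isBigO_one ℝ
    have := (Asymptotics.isBigO_of_le (𝓝 x) (f := fun y => Φ y (h y - h x - h' (y - x)))
      (g := fun y => ‖Φ y‖ * ‖h y - h x - h' (y - x)‖) fun y => by
        rw [Real.norm_of_nonneg (by positivity)]
        exact (Φ y).le_opNorm _).trans_isLittleO
      (hb.norm_left.mul_isLittleO hh.norm_norm)
    simpa using this
  have h2 : (fun y => (Φ y - Φ x) (h' (y - x))) =o[𝓝 x] fun y => y - x := by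
    have hb : (fun y => Φ y - Φ x) =o[𝓝 x] fun _ => (1 : ℝ) := by
      rw [Asymptotics.isLittleO_one_iff]
      simpa using hΦ.sub_const (Φ x)
    have := (Asymptotics.isBigO_of_le (𝓝 x) (f := fun y => (Φ y - Φ x) (h' (y - x)))
      (g := fun y => ‖Φ y - Φ x‖ * ‖h' (y - x)‖) fun y => by
        rw [Real.norm_of_nonneg (by positivity)]
        exact (Φ y - Φ x).le_opNorm _).trans_isLittleO
      (hb.norm_left.mul_isBigO (h'.isBigO_sub (𝓝 x) x).norm_norm)
    simpa using this
  refine (h1.add h2).congr_left fun y => ?_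
  simp [hx]

theorem sum_ite_eq_smul {I X : Type*} [Fintype I] [DecidableEq I] [AddCommGroup X] [Module ℝ X]
    (f : I → I → X) : ∑ p, ∑ q, (if p = q then (1 : ℝ) else 0) • f p q = ∑ p, f p p := by
  simp

/-! ### The anticommutator `DZ + ZD` on sections of type `ρ`, and its value at the fixed point. -/

namespace CliffordGerm

variable {n m r : ℕ} {k : Fin n → Fin m → ℤ} {a : Fin r → Fin m → ℤ} (S : CliffordGerm k a)

theorem U_mem_nhds {x : Tangent n} (hx : x ∈ S.U) : S.U ∈ 𝓝 x := S.isOpen_U.mem_nhds hx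

theorem c_anticomm {x : Tangent n} (hx : x ∈ S.U) (v w : Tangent n) (e : Fiber r) :
    S.c x v (S.c x w e) + S.c x w (S.c x v e) = (-2 * S.g x v w) • e := by
  have h := congrArg (fun T : Fiber r →L[ℂ] Fiber r => T e) (S.c_clifford x hx v w)
  simp only [add_apply, ContinuousLinearMap.comp_apply] at h
  rw [h]
  ext j
  simp

theorem gram_mulVec (x : Tangent n) (v : Fin n × Fin 2 → ℝ) (p : Fin n × Fin 2) :
    (S.gram x).mulVec v p = S.g x (realBasis p) (∑ q, v q • realBasis q) := by
  simp [Matrix.mulVec, dotProduct, gram, mul_comm]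

/-- A null vector of the Gram matrix would give a nonzero tangent vector of length zero. -/
theorem isUnit_det_gram {x : Tangent n} (hx : x ∈ S.U) : IsUnit (S.gram x).det := by
  rw [isUnit_iff_ne_zero]
  intro h0
  obtain ⟨v, hv, hmul⟩ := Matrix.exists_mulVec_eq_zero_iff.2 h0
  set w : Tangent n := ∑ q, v q • realBasis q with hw
  have h1 : S.g x w w = 0 := by
    have h2 : ∀ p, S.g x (realBasis p) w = 0 := fun p => by
      rw [← gram_mulVec, hmul]; rfl
    have h3 : S.g x w = ∑ q, v q • S.g x (realBasis q) := by simp only [hw, map_sum, map_smul]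
    rw [h3]
    simp only [sum_apply, smul_apply, h2, smul_zero, Finset.sum_const_zero]
  have hw0 : w = 0 := by
    by_contra hne
    exact (S.g_pos x hx w hne).ne' h1
  apply hv
  have hli := orthonormal_realBasis (n := n) |>.linearIndependent
  exact funext fun q => (Fintype.linearIndependent_iff.1 hli) v (hw ▸ hw0) q

theorem gram_isSymm {x : Tangent n} (hx : x ∈ S.U) : (S.gram x).transpose = S.gram x := by
  ext p q
  simp [gram, Matrix.transpose_apply, S.g_symm x hx]

/-- Raising an index: `∑_p g^{pq} g(∂_p, v)` is the `q`-th coordinate of `v`. -/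
theorem sum_gram_inv_mul {x : Tangent n} (hx : x ∈ S.U) (v : Tangent n) (q : Fin n × Fin 2) :
    ∑ p, (S.gram x)⁻¹ p q * S.g x (realBasis p) v = realCoord v q := by
  have h1 : ∀ p, S.g x (realBasis p) v = (S.gram x).mulVec (realCoord v) p := fun p => by
    rw [gram_mulVec, sum_realCoord]
  have h2 : ∀ p, (S.gram x)⁻¹ p q = (S.gram x)⁻¹ q p := fun p => by
    have := Matrix.transpose_nonsing_inv (S.gram x)
    rw [S.gram_isSymm hx] at this
    exact congrFun (congrFun this q) p
  simp only [h1, h2]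
  change ((S.gram x)⁻¹.mulVec ((S.gram x).mulVec (realCoord v))) q = _
  rw [Matrix.mulVec_mulVec, Matrix.nonsing_inv_mul _ (S.isUnit_det_gram hx), Matrix.one_mulVec]

theorem gram_zero : S.gram 0 = 1 := by
  ext p q
  rw [gram, Matrix.of_apply, S.g_zero, orthonormal_iff_ite.1 orthonormal_realBasis p q,
    Matrix.one_apply]

theorem gram_inv_zero (p q : Fin n × Fin 2) :
    (S.gram 0)⁻¹ p q = if p = q then 1 else 0 := by
  rw [S.gram_zero, inv_one, Matrix.one_apply]

theorem continuousOn_gram_inv (p q : Fin n × Fin 2) :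
    ContinuousOn (fun x => (S.gram x)⁻¹ p q) S.U := by
  have hg : ContinuousOn S.gram S.U := by
    refine continuousOn_pi.2 fun p => continuousOn_pi.2 fun q => ?_
    exact (S.g_smooth.continuousOn.clm_apply continuousOn_const).clm_apply continuousOn_const
  have hdet : ContinuousOn (fun x => (S.gram x).det) S.U :=
    (Continuous.matrix_det continuous_id).comp_continuousOn hg
  have hadj : ContinuousOn (fun x => (S.gram x).adjugate p q) S.U :=
    ((continuous_apply_apply p q).comp
      (Continuous.matrix_adjugate continuous_id)).comp_continuousOn hg
  have h : ∀ x, (S.gram x)⁻¹ p q = ((S.gram x).det)⁻¹ * (S.gram x).adjugate p q := fun x => by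
    simp [Matrix.inv_def, Matrix.smul_apply]
  simp only [h]
  exact (hdet.inv₀ fun x hx => (S.isUnit_det_gram hx).ne_zero).mul hadj

set_option maxSynthPendingDepth 6 in
theorem continuousOn_fderiv_c (v : Tangent n) :
    ContinuousOn (fun x => fderiv ℝ S.c x v) S.U :=
  (S.c_smooth.continuousOn_fderiv_of_isOpen S.isOpen_U (by simp)).clm_apply continuousOn_const

variable (τ : Fin m → ℝ) (b : Fin m → ℤ)

/-- The derivative of `c(V)` in the direction `v`. -/
noncomputable def derivCliffordField (x v : Tangent n) : Fiber r →L[ℂ] Fiber r :=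
  fderiv ℝ S.c x v (inducedCLM k τ x) + S.c x (inducedCLM k τ v)

theorem hasFDerivAt_c {x : Tangent n} (hx : x ∈ S.U) :
    HasFDerivAt S.c (fderiv ℝ S.c x) x :=
  ((S.c_smooth.contDiffAt (S.U_mem_nhds hx)).differentiableAt (by simp)).hasFDerivAt

theorem fderiv_Z {x : Tangent n} (hx : x ∈ S.U) :
    HasFDerivAt (S.Z τ) (fderiv ℝ (S.Z τ) x) x ∧
      ∀ v, fderiv ℝ (S.Z τ) x v = Complex.I • S.derivCliffordField τ x v := by
  have h1 := ((S.hasFDerivAt_c hx).clm_apply (inducedCLM k τ).hasFDerivAt).fun_const_smul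
    Complex.I
  have h2 : S.Z τ = fun y => Complex.I • S.c y (inducedCLM k τ y) := by
    funext y
    rw [Z, inducedField_eq]
  rw [h2]
  refine ⟨h1.differentiableAt.hasFDerivAt, fun v => ?_⟩
  rw [HasFDerivAt.fderiv h1]
  simp [derivCliffordField, add_comm]

/-- The diagonal endomorphism `2 (b·τ + a_j·τ)`. -/
noncomputable def weightEndo (a : Fin r → Fin m → ℤ) : Fiber r →L[ℂ] Fiber r :=
  LinearMap.toContinuousLinearMap
    { toFun := fun w => WithLp.toLp 2 fun j => (2 * (pairing (a j) τ + pairing b τ : ℝ) : ℂ) * w j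
      map_add' := fun z w => by ext l; simp [mul_add]
      map_smul' := fun c z => by ext l; simp; ring }

theorem weightEndo_apply (w : Fiber r) (j : Fin r) :
    weightEndo τ b a w j = (2 * (pairing (a j) τ + pairing b τ : ℝ) : ℂ) * w j := rfl

/-- A bundle map to which `DZ + ZD` restricts on sections of type `ρ`. -/
noncomputable def restrictedEndo (x : Tangent n) : Fiber r →L[ℂ] Fiber r :=
  ∑ p, ∑ q, (S.gram x)⁻¹ p q • (Complex.I •
    (S.c x (realBasis p) ∘L S.derivCliffordField τ x (realBasis q) +
      S.c x (realBasis p) ∘L S.conn x (realBasis q) ∘L S.c x (inducedCLM k τ x) +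
      S.c x (inducedCLM k τ x) ∘L S.c x (realBasis p) ∘L S.conn x (realBasis q))) +
  weightEndo τ b a

theorem continuousOn_restrictedEndo : ContinuousOn (S.restrictedEndo τ b) S.U := by
  have hc := S.c_smooth.continuousOn
  have hn := S.conn_smooth.continuousOn
  have hV : ContinuousOn (inducedCLM k τ) S.U := (inducedCLM k τ).continuous.continuousOn
  have hcV : ContinuousOn (fun x => S.c x (inducedCLM k τ x)) S.U := hc.clm_apply hV
  have hcp : ∀ v, ContinuousOn (fun x => S.c x v) S.U := fun v => hc.clm_apply continuousOn_const
  have hnp : ∀ v, ContinuousOn (fun x => S.conn x v) S.U :=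
    fun v => hn.clm_apply continuousOn_const
  have hd : ∀ v, ContinuousOn (fun x => S.derivCliffordField τ x v) S.U := fun v =>
    ((S.continuousOn_fderiv_c v).clm_apply hV).add (hcp _)
  refine ContinuousOn.add (continuousOn_finsetSum _ fun p _ => continuousOn_finsetSum _ fun q _ =>
    (S.continuousOn_gram_inv p q).smul (ContinuousOn.fun_const_smul ?_ _)) continuousOn_const
  exact (((hcp _).clm_comp (hd _)).add ((hcp _).clm_comp ((hnp _).clm_comp hcV))).add
    (hcV.clm_comp ((hcp _).clm_comp (hnp _)))

/-- By the Leibniz rule `∂_q u` appears with the coefficient `i (c(e_p) c(V) + c(V) c(e_p)) = -2i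
g(e_p, V)`. Contracting with the inverse metric leaves `-2i ∂_V u`, and equivariance of `u` converts
this into a diagonal endomorphism. -/
theorem anticommutator_eq {u : Tangent n → Fiber r} (hu : ContDiffOn ℝ ∞ u S.U)
    (ht : IsOfType k a b S.U u) {x : Tangent n} (hx : x ∈ S.U) :
    S.anticommutator τ u x = S.restrictedEndo τ b x (u x) := by
  have hdu : DifferentiableAt ℝ u x :=
    (hu.contDiffAt (S.U_mem_nhds hx)).differentiableAt (by simp)
  obtain ⟨hZ, hZ'⟩ := S.fderiv_Z τ hx
  set V := inducedCLM k τ x with hVdef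
  have hZx : ∀ w, S.Z τ x w = Complex.I • S.c x V w := fun w => by
    rw [Z, inducedField_eq]; rfl
  have hfd : ∀ v, fderiv ℝ (fun y => S.Z τ y (u y)) x v =
      Complex.I • S.c x V (fderiv ℝ u x v) + Complex.I • S.derivCliffordField τ x v (u x) := by
    intro v
    -- `Z` takes complex linear values while the differentiation is real, so scalars are restricted
    -- before the product rule.
    have h1 : HasFDerivAt (fun y => (S.Z τ y).restrictScalars ℝ)
        (ContinuousLinearMap.restrictScalarsL ℂ (Fiber r) (Fiber r) ℝ ℝ ∘L
          fderiv ℝ (S.Z τ) x) x :=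
      (ContinuousLinearMap.restrictScalarsL ℂ (Fiber r) (Fiber r) ℝ ℝ).hasFDerivAt.comp x hZ
    have h2 := h1.clm_apply hdu.hasFDerivAt
    have h3 : (fun y => S.Z τ y (u y)) = fun y => ((S.Z τ y).restrictScalars ℝ) (u y) := rfl
    rw [h3, h2.fderiv]
    simp [hZ', hZx]
  have hVsum : ∑ p, ∑ q, (S.gram x)⁻¹ p q • ((-2 * S.g x (realBasis p) V) •
      fderiv ℝ u x (realBasis q)) = (-2 : ℝ) • fderiv ℝ u x V := by
    rw [Finset.sum_comm]
    conv_rhs => rw [← sum_realCoord V, map_sum, Finset.smul_sum]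
    refine Finset.sum_congr rfl fun q _ => ?_
    rw [map_smul, ← S.sum_gram_inv_mul hx V q, Finset.sum_smul, Finset.smul_sum]
    refine Finset.sum_congr rfl fun p _ => ?_
    module
  have hterm : ∀ p q, S.c x (realBasis p) (S.nabla (fun y => S.Z τ y (u y)) x (realBasis q)) +
      S.Z τ x (S.c x (realBasis p) (S.nabla u x (realBasis q))) =
      Complex.I • ((-2 * S.g x (realBasis p) V) • fderiv ℝ u x (realBasis q)) +
      (Complex.I •
        (S.c x (realBasis p) ∘L S.derivCliffordField τ x (realBasis q) +
          S.c x (realBasis p) ∘L S.conn x (realBasis q) ∘L S.c x V +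
          S.c x V ∘L S.c x (realBasis p) ∘L S.conn x (realBasis q))) (u x) := by
    intro p q
    rw [← S.c_anticomm hx]
    simp only [nabla, hfd, hZx, map_add, map_smul, add_apply, smul_apply, smul_add,
      ContinuousLinearMap.comp_apply]
    abel
  have hI : Complex.I • ((-2 : ℝ) • fderiv ℝ u x V) = weightEndo τ b a (u x) := by
    ext j
    simp only [PiLp.smul_apply, hVdef, ht.fderiv_inducedCLM k τ hx hdu, weightEndo_apply,
      smul_eq_mul, Complex.real_smul]
    push_cast
    linear_combination (-2 * ((pairing (a j) τ : ℂ) + pairing b τ) * u x j) * Complex.I_mul_I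
  rw [anticommutator, dirac, dirac, restrictedEndo, add_apply, ← hI, ← hVsum]
  simp only [map_sum, sum_apply, smul_apply, Finset.smul_sum, ← Finset.sum_add_distrib]
  refine Finset.sum_congr rfl fun p _ => Finset.sum_congr rfl fun q _ => ?_
  rw [ContinuousLinearMap.map_smul_of_tower, ← smul_add, hterm, smul_add, add_comm]
  congr 1
  rw [smul_comm]

theorem isRestriction_restrictedEndo : S.IsRestriction τ b (S.restrictedEndo τ b) :=
  ⟨S.continuousOn_restrictedEndo τ b, fun _ hu ht _ hx => S.anticommutator_eq τ b hu ht hx⟩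

/-- At the origin `V = 0` removes the derivative of `c` and both connection terms, leaving `i ∑
c(e_p) c(∂_p V)`. As `∂_{x_l} V = κ_l ∂_{y_l}` and `∂_{y_l} V = -κ_l ∂_{x_l}`, anticommutation makes
the two summands for each `l` equal, whence the factor 2. -/
theorem restrictedEndo_zero {ε : Fin r → Fin n → ℤ}
    (hε : ∀ j l,
      Complex.I • S.c 0 (realBasis (l, 0)) (S.c 0 (realBasis (l, 1)) (EuclideanSpace.single j 1)) =
        (ε j l : ℂ) • EuclideanSpace.single j (1 : ℂ)) (w : Fiber r) (j : Fin r) :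
    S.restrictedEndo τ b 0 w j =
      ((2 * pairing b τ + 2 * pairing (a j) τ + 2 * ∑ l, pairing (k l) τ * ε j l : ℝ) : ℂ) * w j := by
  have hcc : ∀ l, Complex.I • S.c 0 (realBasis (l, 0)) (S.c 0 (realBasis (l, 1)) w) =
      WithLp.toLp 2 fun j => (ε j l : ℂ) * w j := fun l => by
    have hw : w = ∑ i, w i • EuclideanSpace.single i (1 : ℂ) := by
      ext i
      simp [Pi.single_apply]
    conv_lhs => rw [hw]
    simp only [map_sum, map_smul, Finset.smul_sum, smul_comm Complex.I, hε]
    ext i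
    simp [Pi.single_apply, mul_comm]
  have hcc' : ∀ l, S.c 0 (realBasis (l, 1)) (S.c 0 (realBasis (l, 0)) w) =
      -S.c 0 (realBasis (l, 0)) (S.c 0 (realBasis (l, 1)) w) := fun l => by
    have h := S.c_anticomm S.zero_mem (realBasis (l, 1)) (realBasis (l, 0)) w
    rw [S.g_zero, orthonormal_iff_ite.1 orthonormal_realBasis, if_neg (by simp), mul_zero,
      zero_smul] at h
    exact eq_neg_of_add_eq_zero_left h
  have hsum : S.restrictedEndo τ b 0 w =
      ∑ l, (2 * pairing (k l) τ : ℝ) • (WithLp.toLp 2 fun j => (ε j l : ℂ) * w j) +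
        weightEndo τ b a w := by
    rw [restrictedEndo, add_apply]
    congr 1
    simp only [S.gram_inv_zero, sum_apply, smul_apply]
    rw [sum_ite_eq_smul]
    simp only [map_zero, ContinuousLinearMap.comp_zero, ContinuousLinearMap.zero_comp, add_zero,
      derivCliffordField, zero_add, Fintype.sum_prod_type, Fin.sum_univ_two,
      ContinuousLinearMap.comp_apply]
    refine Finset.sum_congr rfl fun l _ => ?_
    rw [(inducedCLM_realBasis k τ l).1, (inducedCLM_realBasis k τ l).2]
    simp only [map_neg, map_smul, neg_apply, smul_apply,
      ContinuousLinearMap.map_smul_of_tower, hcc', smul_neg, neg_neg]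
    rw [smul_comm, hcc]
    module
  rw [hsum, PiLp.add_apply, weightEndo_apply, WithLp.ofLp_sum, Finset.sum_apply]
  push_cast
  simp only [PiLp.smul_apply, Complex.real_smul]
  push_cast
  rw [add_mul, Finset.mul_sum, Finset.sum_mul]
  rw [add_comm]
  congr 1
  · ring
  · exact Finset.sum_congr rfl fun l _ => by ring

variable {τ b} in
/-- All the bundle maps to which `DZ + ZD` restricts have the same effect at the fixed point on the
values of sections of type `ρ`. -/
theorem IsRestriction.apply_zero {β β' : Tangent n → (Fiber r →L[ℂ] Fiber r)}
    (h : S.IsRestriction τ b β) (h' : S.IsRestriction τ b β') {u : Tangent n → Fiber r}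
    (hu : ContDiff ℝ ∞ u) (ht : IsOfType k a b univ u) (z : Tangent n) :
    β 0 (u z) = β' 0 (u z) := by
  have hlim : ∀ γ : Tangent n → (Fiber r →L[ℂ] Fiber r), ContinuousOn γ S.U →
      Tendsto (fun t : ℝ => γ (t • z) (u z)) (𝓝[≠] 0) (𝓝 (γ 0 (u z))) := fun γ hγ => by
    have h1 : ContinuousAt γ ((0 : ℝ) • z) := by
      rw [zero_smul]
      exact hγ.continuousAt (S.U_mem_nhds S.zero_mem)
    have h2 : ContinuousAt (fun t : ℝ => γ (t • z) (u z)) 0 :=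
      (h1.comp (f := fun t : ℝ => t • z) (by fun_prop)).clm_apply continuousAt_const
    have h3 := h2.tendsto
    simp only [zero_smul] at h3
    exact h3.mono_left nhdsWithin_le_nhds
  refine tendsto_nhds_unique_of_eventuallyEq (hlim β h.1) (hlim β' h'.1) ?_
  have hU : ∀ᶠ t : ℝ in 𝓝[≠] 0, t • z ∈ S.U := by
    have h1 : Tendsto (fun t : ℝ => t • z) (𝓝 0) (𝓝 ((0 : ℝ) • z)) :=
      (continuous_id.smul continuous_const).tendsto 0
    rw [zero_smul] at h1
    exact (h1.mono_left nhdsWithin_le_nhds).eventually (S.U_mem_nhds S.zero_mem)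
  filter_upwards [hU, self_mem_nhdsWithin] with t htU ht0
  -- Dilations commute with the torus action, so the rescaled section is again of type `ρ`, and it
  -- takes the value `u z` at `t • z`. Both bundle maps therefore agree on `u z` at points tending
  -- to the origin.
  have hs : ContDiff ℝ ∞ fun y => u (t⁻¹ • y) := hu.comp (contDiff_const_smul _)
  have hst : IsOfType k a b S.U fun y => u (t⁻¹ • y) := fun θ x _ => by
    change torusAct a (-θ) (u (t⁻¹ • torusAct k θ x)) = _
    rw [← torusAct_smul_real]
    exact ht θ (t⁻¹ • x) (mem_univ _)
  have e : u (t⁻¹ • t • z) = u z := by rw [inv_smul_smul₀ ht0]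
  have h1 := h.2 _ hs.contDiffOn hst _ htU
  have h2 := h'.2 _ hs.contDiffOn hst _ htU
  rw [h1] at h2
  simpa only [e] using h2

end CliffordGerm

end WittenModel

namespace WittenModel

open Filter Topology

/-! ### The principal part of `D²` and the quadratic part of `Z²` at the fixed point. -/

theorem two_le_infty : (2 : WithTop ℕ∞) ≤ ∞ := ENat.LEInfty.out

namespace CliffordGerm

variable {n m r : ℕ} {k : Fin n → Fin m → ℤ} {a : Fin r → Fin m → ℤ} (S : CliffordGerm k a)

theorem continuousAt_restrictScalars {T : Tangent n → (Fiber r →L[ℂ] Fiber r)}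
    (hT : ContinuousOn T S.U) :
    ContinuousAt (fun y => (T y).restrictScalars ℝ) 0 :=
  (ContinuousLinearMap.restrictScalarsL ℂ (Fiber r) (Fiber r) ℝ ℝ).continuous.continuousAt.comp
    (hT.continuousAt (S.U_mem_nhds S.zero_mem))

/-- The derivative at the fixed point of `T w` for a section `w` that vanishes there. -/
theorem hasFDerivAt_endo_apply {T : Tangent n → (Fiber r →L[ℂ] Fiber r)} (hT : ContinuousOn T S.U)
    {w : Tangent n → Fiber r} {w' : Tangent n →L[ℝ] Fiber r} (hw : w 0 = 0)
    (hd : HasFDerivAt w w' 0) :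
    HasFDerivAt (fun y => T y (w y)) ((T 0).restrictScalars ℝ ∘L w') 0 :=
  hasFDerivAt_clm_apply_of_eq_zero (S.continuousAt_restrictScalars hT) hw hd

theorem continuousOn_c (v : Tangent n) : ContinuousOn (fun x => S.c x v) S.U :=
  S.c_smooth.continuousOn.clm_apply continuousOn_const

theorem continuousOn_conn (v : Tangent n) : ContinuousOn (fun x => S.conn x v) S.U :=
  S.conn_smooth.continuousOn.clm_apply continuousOn_const

theorem dirac_zero_of_eq_zero {w : Tangent n → Fiber r} (hw : w 0 = 0) :
    S.dirac w 0 = ∑ p, S.c 0 (realBasis p) (fderiv ℝ w 0 (realBasis p)) := by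
  simp only [dirac, S.gram_inv_zero, nabla, hw, map_zero, add_zero]
  rw [sum_ite_eq_smul]

variable (A : Tangent n →L[ℝ] Tangent n →L[ℝ] Fiber r)

theorem hasFDerivAt_quadratic (hA : ∀ v w, A v w = A w v) (y : Tangent n) :
    HasFDerivAt (fun y => (1 / 2 : ℝ) • A y y) (A y) y := by
  refine ((A.hasFDerivAt.clm_apply (hasFDerivAt_id y)).fun_const_smul (1 / 2 : ℝ)).congr_fderiv ?_
  ext1 v
  simp [hA v y]
  module

theorem dirac_quadratic_zero : S.dirac (fun y => (1 / 2 : ℝ) • A y y) 0 = 0 := by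
  have h : HasFDerivAt (fun y => (1 / 2 : ℝ) • A y y) (0 : Tangent n →L[ℝ] Fiber r) 0 := by
    have h1 := hasFDerivAt_clm_apply_of_eq_zero (Φ := A) (h := id) A.continuous.continuousAt rfl
      (hasFDerivAt_id (0 : Tangent n))
    simpa using h1.fun_const_smul (1 / 2 : ℝ)
  rw [S.dirac_zero_of_eq_zero (by simp)]
  simp [h.fderiv, -one_div]

/-- The covariant derivative of a quadratic section vanishes at the origin, so to first order the
coefficients of `D` contribute only their values there and their continuity suffices. -/
theorem hasFDerivAt_dirac_quadratic (hA : ∀ v w, A v w = A w v) :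
    HasFDerivAt (S.dirac fun y => (1 / 2 : ℝ) • A y y)
      (∑ p, (S.c 0 (realBasis p)).restrictScalars ℝ ∘L A.flip (realBasis p)) 0 := by
  have hq : ∀ q, HasFDerivAt (fun y => S.nabla (fun y => (1 / 2 : ℝ) • A y y) y (realBasis q))
      (A.flip (realBasis q)) 0 := fun q => by
    have h0 := hasFDerivAt_quadratic A hA 0
    have h1 := S.hasFDerivAt_endo_apply (S.continuousOn_conn (realBasis q))
      (w := fun y => (1 / 2 : ℝ) • A y y) (by simp) h0
    have h2 := (A.flip (realBasis q)).hasFDerivAt (x := (0 : Tangent n)) |>.add h1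
    simp only [map_zero, ContinuousLinearMap.comp_zero, add_zero] at h2
    refine h2.congr_of_eventuallyEq (Eventually.of_forall fun y => ?_)
    simp [nabla, (hasFDerivAt_quadratic A hA y).fderiv, -one_div]
  have hz : ∀ q, S.nabla (fun y => (1 / 2 : ℝ) • A y y) 0 (realBasis q) = 0 := fun q => by
    simp [nabla, (hasFDerivAt_quadratic A hA 0).fderiv, -one_div]
  have hpq : ∀ p q, HasFDerivAt (fun y => (S.gram y)⁻¹ p q • S.c y (realBasis p)
      (S.nabla (fun y => (1 / 2 : ℝ) • A y y) y (realBasis q)))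
      ((if p = q then (1 : ℝ) else 0) •
        ((S.c 0 (realBasis p)).restrictScalars ℝ ∘L A.flip (realBasis q))) 0 := fun p q => by
    have h1 := S.hasFDerivAt_endo_apply (T := fun y => (S.gram y)⁻¹ p q • S.c y (realBasis p))
      ((S.continuousOn_gram_inv p q).smul (S.continuousOn_c _)) (hz q) (hq q)
    refine h1.congr_fderiv ?_
    ext1 v
    change ((S.gram 0)⁻¹ p q • S.c 0 (realBasis p)) (A v (realBasis q)) = _
    rw [S.gram_inv_zero]
    rfl
  have h := HasFDerivAt.fun_sum (u := Finset.univ) fun p _ =>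
    HasFDerivAt.fun_sum (u := Finset.univ) fun q _ => hpq p q
  refine h.congr_fderiv ?_
  rw [sum_ite_eq_smul]

/-- In `∑ c(e_p) c(e_q) A(e_p, e_q)` the symmetry of `A` allows `c(e_p) c(e_q)` to be replaced by
its symmetrization `-δ_{pq}`. -/
theorem dirac_dirac_quadratic (hA : ∀ v w, A v w = A w v) :
    S.dirac (S.dirac fun y => (1 / 2 : ℝ) • A y y) 0 = -∑ p, A (realBasis p) (realBasis p) := by
  rw [S.dirac_zero_of_eq_zero (S.dirac_quadratic_zero A),
    (S.hasFDerivAt_dirac_quadratic A hA).fderiv]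
  simp only [sum_apply, ContinuousLinearMap.comp_apply, map_sum,
    ContinuousLinearMap.coe_restrictScalars', ContinuousLinearMap.flip_apply]
  set X := ∑ p, ∑ q, S.c 0 (realBasis p) (S.c 0 (realBasis q) (A (realBasis p) (realBasis q)))
    with hX
  have hX' : X = ∑ p, ∑ q,
      S.c 0 (realBasis q) (S.c 0 (realBasis p) (A (realBasis p) (realBasis q))) := by
    rw [hX, Finset.sum_comm]
    exact Finset.sum_congr rfl fun p _ => Finset.sum_congr rfl fun q _ => by rw [hA]
  have h2 : X + X = (-2 : ℝ) • ∑ p, A (realBasis p) (realBasis p) := by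
    nth_rewrite 2 [hX']
    rw [hX]
    simp only [← Finset.sum_add_distrib, S.c_anticomm S.zero_mem, S.g_zero,
      orthonormal_iff_ite.1 orthonormal_realBasis, Finset.smul_sum]
    simp
  have h3 : X = (1 / 2 : ℝ) • (X + X) := by module
  rw [h3, h2]
  module

theorem principalPart_eq {u : Tangent n → Fiber r} (hu : ContDiff ℝ ∞ u) (z : Tangent n) :
    principalPart (fun v => S.dirac (S.dirac v)) u z = -Laplacian.laplacian u z := by
  have hA : ∀ v w, fderiv ℝ (fderiv ℝ u) z v w = fderiv ℝ (fderiv ℝ u) z w v := fun v w =>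
    (hu.contDiffAt (x := z)).isSymmSndFDerivAt
      (by rw [minSmoothness_of_isRCLikeNormedField]; exact two_le_infty) v w
  have h := S.dirac_dirac_quadratic _ hA
  rw [InnerProductSpace.laplacian_eq_iteratedFDeriv_orthonormalBasis u realONB]
  simp only [principalPart, iteratedFDeriv_two_apply, realONB_apply]
  exact h

variable (τ : Fin m → ℝ)

theorem Z_zero : S.Z τ 0 = 0 := by
  ext1 e
  simp [Z, inducedField_eq]

/-- Because `Z` vanishes at the origin, the second derivative of `Z²` along `x` is twice the square
of the first derivative of `Z`, and `(i c(V x))² = |V x|²`. -/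
theorem quadraticPart_eq (x : Tangent n) :
    quadraticPart (fun y => S.Z τ y ∘L S.Z τ y) x =
      ((∑ l, pairing (k l) τ ^ 2 * ‖x l‖ ^ 2 : ℝ) : ℂ) • ContinuousLinearMap.id ℂ (Fiber r) := by
  have hZs : ContDiffAt ℝ ∞ (S.Z τ) 0 := by
    have h2 : S.Z τ = fun y => Complex.I • S.c y (inducedCLM k τ y) := by
      funext y
      rw [Z, inducedField_eq]
    rw [h2]
    exact ((S.c_smooth.contDiffAt (S.U_mem_nhds S.zero_mem)).clm_apply
      (inducedCLM k τ).contDiff.contDiffAt).const_smul _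
  let B := (ContinuousLinearMap.compL ℂ (Fiber r) (Fiber r) (Fiber r)).bilinearRestrictScalars ℝ
  have hCs : ContDiffAt ℝ ∞ (fun y => S.Z τ y ∘L S.Z τ y) 0 :=
    B.isBoundedBilinearMap.contDiff.contDiffAt.comp 0 (hZs.prodMk hZs)
  have hZ := (S.fderiv_Z τ S.zero_mem).1
  have hZ' := (S.fderiv_Z τ S.zero_mem).2 x
  have hdC : DifferentiableAt ℝ (fderiv ℝ fun y => S.Z τ y ∘L S.Z τ y) 0 :=
    (hCs.fderiv_right (m := 1) (one_add_one_eq_two.trans_le two_le_infty)).differentiableAt (by simp)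
  have hdZ : DifferentiableAt ℝ (fderiv ℝ (S.Z τ)) 0 :=
    (hZs.fderiv_right (m := 1) (one_add_one_eq_two.trans_le two_le_infty)).differentiableAt (by simp)
  have h1 : fderiv ℝ (fderiv ℝ fun y => S.Z τ y ∘L S.Z τ y) 0 x x =
      fderiv ℝ (fun y => fderiv ℝ (fun y => S.Z τ y ∘L S.Z τ y) y x) 0 x := by
    rw [fderiv_clm_apply hdC (differentiableAt_const x)]
    simp
  have h2 : (fun y => fderiv ℝ (fun y => S.Z τ y ∘L S.Z τ y) y x) =ᶠ[𝓝 0]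
      fun y => S.Z τ y ∘L fderiv ℝ (S.Z τ) y x + fderiv ℝ (S.Z τ) y x ∘L S.Z τ y := by
    filter_upwards [S.U_mem_nhds S.zero_mem] with y hy
    have hZy := (S.fderiv_Z τ hy).1
    refine (congrArg (fun T => T x) (B.hasFDerivAt_of_bilinear hZy hZy).fderiv).trans ?_
    simp [B]
  have h3 : HasFDerivAt (fun y => fderiv ℝ (S.Z τ) y x)
      ((fderiv ℝ (fderiv ℝ (S.Z τ)) 0).flip x) 0 := by
    have := hdZ.hasFDerivAt.clm_apply (hasFDerivAt_const x (0 : Tangent n))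
    simpa using this
  have h4 := ((B.hasFDerivAt_of_bilinear hZ h3).add (B.hasFDerivAt_of_bilinear h3 hZ)).fderiv
  rw [quadraticPart, iteratedFDeriv_two_apply]
  change (1 / 2 : ℝ) • fderiv ℝ (fderiv ℝ fun y => S.Z τ y ∘L S.Z τ y) 0 x x = _
  rw [h1, h2.fderiv_eq]
  -- The terms with a second derivative of `Z` carry the factor `Z 0 = 0`.
  have h5 : fderiv ℝ (fun y => S.Z τ y ∘L fderiv ℝ (S.Z τ) y x +
      fderiv ℝ (S.Z τ) y x ∘L S.Z τ y) 0 x =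
      fderiv ℝ (S.Z τ) 0 x ∘L fderiv ℝ (S.Z τ) 0 x +
        fderiv ℝ (S.Z τ) 0 x ∘L fderiv ℝ (S.Z τ) 0 x := by
    refine (congrArg (fun T => T x) h4).trans ?_
    simp [S.Z_zero, B]
  rw [h5, hZ']
  ext1 e
  have h6 := S.c_anticomm S.zero_mem (inducedCLM k τ x) (inducedCLM k τ x) e
  have h7 : S.derivCliffordField τ 0 x = S.c 0 (inducedCLM k τ x) := by
    simp [derivCliffordField]
  rw [S.g_zero, norm_sq_inducedCLM] at h6
  simp only [smul_apply, add_apply, ContinuousLinearMap.comp_apply, h7, map_smul, smul_smul,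
    Complex.I_mul_I, ContinuousLinearMap.id_apply, ← smul_add, h6]
  ext j
  simp
  ring

theorem modelOperator_eq {b : Fin m → ℤ} {β : Tangent n → (Fiber r →L[ℂ] Fiber r)}
    (hβ : S.IsRestriction τ b β) {ε : Fin r → Fin n → ℤ}
    (hε : ∀ j l,
      Complex.I • S.c 0 (realBasis (l, 0)) (S.c 0 (realBasis (l, 1)) (EuclideanSpace.single j 1)) =
        (ε j l : ℂ) • EuclideanSpace.single j (1 : ℂ))
    {u : Tangent n → Fiber r} (hu : ContDiff ℝ ∞ u) (ht : IsOfType k a b univ u) (z : Tangent n)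
    (j : Fin r) :
    S.modelOperator τ β u z j =
      -(Laplacian.laplacian u z j) +
        ((∑ l, pairing (k l) τ ^ 2 * ‖z l‖ ^ 2 : ℝ) : ℂ) * u z j +
        ((2 * pairing b τ + 2 * pairing (a j) τ +
          2 * ∑ l, pairing (k l) τ * ε j l : ℝ) : ℂ) * u z j := by
  -- Only `β 0` applied to values of `u` enters, so `β` may be exchanged for the explicit
  -- `restrictedEndo`.
  rw [modelOperator, S.principalPart_eq hu, quadraticPart_eq,
    hβ.apply_zero S (S.isRestriction_restrictedEndo τ b) hu ht, PiLp.add_apply, PiLp.add_apply,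
    S.restrictedEndo_zero τ b hε]
  simp only [PiLp.neg_apply, smul_apply, ContinuousLinearMap.id_apply, PiLp.smul_apply, smul_eq_mul]
  ring

end CliffordGerm

end WittenModel

namespace WittenModel

/-! ### A Hilbert basis of the square integrable sections of type `ρ`. -/

section L2

open scoped ComplexConjugate

variable {n m r : ℕ} (k : Fin n → Fin m → ℤ) (a : Fin r → Fin m → ℤ) (b : Fin m → ℤ)

/-- The diagonal endomorphism by which sections of type `ρ` transform under `θ`. -/
noncomputable def typeEndo (θ : Fin m → ℝ) : Fiber r →L[ℂ] Fiber r :=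
  LinearMap.toContinuousLinearMap
    { toFun := fun w => WithLp.toLp 2 fun j =>
        Complex.exp (Complex.I * (pairing (a j) θ + pairing b θ : ℝ)) * w j
      map_add' := fun z w => by ext l; simp [mul_add]
      map_smul' := fun c z => by ext l; simp; ring }

variable {k a b} in
theorem mem_L2OfType_iff {f : Lp (Fiber r) 2 (volume : Measure (Tangent n))} :
    f ∈ L2OfType k a b ↔ ∀ θ : Fin m → ℝ, ∀ᵐ x, ∀ j, f (torusAct k θ x) j =
      Complex.exp (Complex.I * (pairing (a j) θ + pairing b θ : ℝ)) * f x j :=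
  forall_congr' fun θ => by simp only [torusAct_neg_eq_iff]

/-- For each `θ` the condition equates two continuous maps on `L²`, the pullback and a constant
endomorphism. Closedness supplies the completeness needed for a Hilbert basis. -/
theorem isClosed_L2OfType :
    IsClosed (L2OfType k a b : Set (Lp (Fiber r) 2 (volume : Measure (Tangent n)))) := by
  have h : (L2OfType k a b : Set (Lp (Fiber r) 2 (volume : Measure (Tangent n)))) =
      ⋂ θ, {f | Lp.compMeasurePreserving (torusAct k θ) (measurePreserving_torusAct k θ) f =
        (typeEndo a b θ).compLpL 2 volume f} := by
    ext f
    simp only [mem_iInter, SetLike.mem_coe, mem_L2OfType_iff, mem_ofPred_eq]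
    refine forall_congr' fun θ => ?_
    rw [Lp.ext_iff]
    have h1 := Lp.coeFn_compMeasurePreserving f (measurePreserving_torusAct k θ)
    have h2 := (typeEndo a b θ).coeFn_compLpL (p := 2) (μ := volume) f
    constructor
    · intro hf
      filter_upwards [hf, h1, h2] with x hx h1 h2
      rw [h1, h2]
      ext j
      exact hx j
    · intro hf
      filter_upwards [hf, h1, h2] with x hx h1 h2 j
      rw [h1, h2] at hx
      exact congrArg (fun w => w j) hx
  rw [h]
  exact isClosed_iInter fun θ => isClosed_eq
    (Lp.isometry_compMeasurePreserving (measurePreserving_torusAct k θ)).continuous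
    ((typeEndo a b θ).compLpL 2 volume).continuous

instance : CompleteSpace (L2OfType k a b) := (isClosed_L2OfType k a b).completeSpace_coe

/-- The section `u e_j`. -/
noncomputable def embed (j : Fin r) : 𝓢(Tangent n, ℂ) →L[ℂ] 𝓢(Tangent n, Fiber r) :=
  SchwartzMap.postcompCLM
    (ContinuousLinearMap.toSpanSingleton ℂ (EuclideanSpace.single j (1 : ℂ) : Fiber r))

@[simp]
theorem embed_apply (j : Fin r) (u : 𝓢(Tangent n, ℂ)) (z : Tangent n) :
    embed j u z = u z • (EuclideanSpace.single j (1 : ℂ) : Fiber r) := rfl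

/-- The `j`-th component of a Schwartz section. -/
noncomputable def component (j : Fin r) : 𝓢(Tangent n, Fiber r) →L[ℂ] 𝓢(Tangent n, ℂ) :=
  SchwartzMap.postcompCLM (EuclideanSpace.proj j : Fiber r →L[ℂ] ℂ)

@[simp]
theorem component_apply (j : Fin r) (s : 𝓢(Tangent n, Fiber r)) (z : Tangent n) :
    component j s z = s z j := rfl

theorem component_embed (i j : Fin r) (u : 𝓢(Tangent n, ℂ)) :
    component i (embed j u) = if i = j then u else 0 := by
  ext z
  split_ifs with h
  · subst h; simp
  · simp [h]

theorem inner_embed (j : Fin r) (u : 𝓢(Tangent n, ℂ))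
    (f : Lp (Fiber r) 2 (volume : Measure (Tangent n))) :
    ⟪(embed j u).toLp 2 volume, f⟫_ℂ = ∫ z, conj (u z) * f z j := by
  rw [L2.inner_def]
  refine integral_congr_ae ?_
  filter_upwards [(embed j u).coeFn_toLp 2 volume] with z hz
  rw [hz, embed_apply, inner_smul_left, EuclideanSpace.inner_single_left]
  simp

theorem oscillator_apply (κ : Fin n → ℝ) (u : 𝓢(Tangent n, ℂ)) (z : Tangent n) :
    oscillator κ u z = -(Laplacian.laplacian (u : Tangent n → ℂ) z) +
      ((∑ l, κ l ^ 2 * ‖z l‖ ^ 2 : ℝ) : ℂ) * u z := by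
  have hΔ : Laplacian.laplacian (u : Tangent n → ℂ) z =
      ∑ l, ((derivOp (realBasis (l, 0)) * derivOp (realBasis (l, 0))) u z +
        (derivOp (realBasis (l, 1)) * derivOp (realBasis (l, 1))) u z) := by
    rw [← SchwartzMap.laplacian_apply, SchwartzMap.laplacian_eq_sum realONB, sum_apply,
      Fintype.sum_prod_type]
    simp only [Fin.sum_univ_two, realONB_apply]
    rfl
  rw [hΔ, oscillator]
  simp only [LinearMap.sum_apply, sum_apply, LinearMap.add_apply, LinearMap.sub_apply,
    LinearMap.neg_apply, LinearMap.smul_apply, Module.End.mul_apply, add_apply, sub_apply,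
    neg_apply, smul_apply, mulOp_apply, coordFun_zero, coordFun_one, smul_eq_mul,
    Complex.ofReal_sum, Finset.sum_mul, ← Finset.sum_neg_distrib, ← Finset.sum_add_distrib]
  refine Finset.sum_congr rfl fun l _ => ?_
  have h := Complex.mul_conj' (z l)
  push_cast
  linear_combination (κ l : ℂ) ^ 2 * u z * h

theorem laplacian_component (s : 𝓢(Tangent n, Fiber r)) (z : Tangent n) (j : Fin r) :
    Laplacian.laplacian (s : Tangent n → Fiber r) z j =
      Laplacian.laplacian (component j s : Tangent n → ℂ) z := by
  have h := ((s.smooth 2).contDiffAt (x := z)).laplacian_CLM_comp_left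
    (l := (EuclideanSpace.proj j : Fiber r →L[ℂ] ℂ).restrictScalars ℝ)
  exact h.symm

variable {k} in
-- When the weights differ, some `θ` multiplies the integrand by `-1`, while the change of variables
-- leaves the integral unchanged.
theorem integral_state_mul_eq_zero {κ : Fin n → ℝ} (hκ : ∀ l, 0 < κ l) {j : Fin r}
    {α : Fin n × Fin 2 → ℕ} (hα : stateWeight k α ≠ a j + b) (f : L2OfType k a b) :
    ∫ z, conj (state hκ α z) * (f : Lp (Fiber r) 2 volume) z j = 0 := by
  obtain ⟨p, hp⟩ := Function.ne_iff.1 hα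
  have hd : (((a j + b) p - stateWeight k α p : ℤ) : ℝ) ≠ 0 := by
    exact_mod_cast sub_ne_zero.2 hp.symm
  set d : ℝ := (((a j + b) p - stateWeight k α p : ℤ) : ℝ) with hdef
  -- The weights differ by `d` in coordinate `p`, so this `θ` makes the relative phase exactly
  -- `e^{iπ}`.
  let θ : Fin m → ℝ := Pi.single p (Real.pi / d)
  have hpair : ∀ w : Fin m → ℤ, pairing w θ = w p * (Real.pi / d) := fun w => by
    simp [pairing, θ, Pi.single_apply]
  have hphase : conj (Complex.exp (Complex.I * (pairing (stateWeight k α) θ : ℝ))) *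
      Complex.exp (Complex.I * (pairing (a j) θ + pairing b θ : ℝ)) = -1 := by
    rw [← Complex.exp_conj, ← Complex.exp_add, ← Complex.exp_pi_mul_I]
    congr 1
    have h1 : (-pairing (stateWeight k α) θ + (pairing (a j) θ + pairing b θ) : ℝ) = Real.pi := by
      rw [hpair, hpair, hpair]
      have h2 : (a j p : ℝ) + b p - stateWeight k α p = d := by simp [hdef]
      rw [← add_mul, ← neg_mul, ← add_mul,
        show -(stateWeight k α p : ℝ) + (a j p + b p) = d by rw [← h2]; ring]
      field_simp
    rw [← h1]
    simp
    ring
  have hcomp : ∫ z, conj (state hκ α (torusAct k θ z)) *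
      (f : Lp (Fiber r) 2 volume) (torusAct k θ z) j =
      ∫ z, conj (state hκ α z) * (f : Lp (Fiber r) 2 volume) z j := by
    have h2 : MeasurableEmbedding (torusAct k θ : Tangent n → Tangent n) := by
      rw [← funext (torusIso_apply k θ)]
      exact (torusIso k θ).toHomeomorph.measurableEmbedding
    exact (measurePreserving_torusAct k θ).integral_comp h2
      fun z => conj (state hκ α z) * (f : Lp (Fiber r) 2 volume) z j
  have hneg : ∫ z, conj (state hκ α (torusAct k θ z)) *
      (f : Lp (Fiber r) 2 volume) (torusAct k θ z) j =
      -∫ z, conj (state hκ α z) * (f : Lp (Fiber r) 2 volume) z j := by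
    rw [← integral_neg]
    refine integral_congr_ae ?_
    filter_upwards [mem_L2OfType_iff.1 f.2 θ] with z hz
    rw [hz j, state_torusAct, map_mul]
    linear_combination conj (state hκ α z) * (f : Lp (Fiber r) 2 volume) z j * hphase
  rw [hcomp] at hneg
  exact self_eq_neg.1 hneg

/-- The states of the harmonic oscillator, normalized in `L²`. -/
noncomputable def normState {κ : Fin n → ℝ} (hκ : ∀ l, 0 < κ l) (α : Fin n × Fin 2 → ℕ) :
    𝓢(Tangent n, ℂ) :=
  ((‖(state hκ α).toLp 2 volume‖⁻¹ : ℝ) : ℂ) • state hκ α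

variable {κ : Fin n → ℝ} (hκ : ∀ l, 0 < κ l)

theorem norm_state_ne_zero (α : Fin n × Fin 2 → ℕ) : ‖(state hκ α).toLp 2 volume‖ ≠ 0 := by
  intro h
  apply state_ne_zero hκ α
  rw [← innerL2_self_eq_zero, innerL2, norm_eq_zero.1 h, inner_zero_left]

theorem innerL2_normState (α β : Fin n × Fin 2 → ℕ) :
    innerL2 (normState hκ α) (normState hκ β) = if α = β then 1 else 0 := by
  rw [normState, normState, innerL2_smul_left, innerL2_smul_right]
  split_ifs with h
  · subst h
    have h1 := norm_state_ne_zero hκ α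
    rw [innerL2, inner_self_eq_norm_sq_to_K, Complex.conj_ofReal]
    have h2 : ((‖(state hκ α).toLp 2 volume‖ : ℝ) : ℂ) ≠ 0 := by exact_mod_cast h1
    push_cast
    change _ * (_ * (‖(state hκ α).toLp 2 volume‖ : ℂ) ^ 2) = 1
    field_simp
  · rw [innerL2_state_of_ne hκ h]
    simp

theorem oscillator_normState (α : Fin n × Fin 2 → ℕ) :
    oscillator κ (normState hκ α) = (energy κ α : ℂ) • normState hκ α := by
  rw [normState, map_smul, oscillator_state, smul_comm]

theorem innerL2_normState_oscillator (α : Fin n × Fin 2 → ℕ) (u : 𝓢(Tangent n, ℂ)) :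
    innerL2 (normState hκ α) (oscillator κ u) = energy κ α * innerL2 (normState hκ α) u := by
  rw [normState, innerL2_smul_left, innerL2_smul_left, innerL2_state_oscillator]
  ring

variable {k a b} in
theorem isOfType_embed_normState {j : Fin r} {α : Fin n × Fin 2 → ℕ}
    (hα : stateWeight k α = a j + b) (U : Set (Tangent n)) :
    IsOfType k a b U (embed j (normState hκ α)) := by
  rw [isOfType_iff]
  intro θ z _ i
  rw [← component_apply, ← component_apply, component_embed]
  split_ifs with h
  · subst h
    rw [normState, smul_apply, smul_apply, state_torusAct, hα, pairing_add_left]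
    simp only [smul_eq_mul]
    ring
  · simp

/-- The pairs of a component and occupation numbers that give sections of type `ρ`. -/
abbrev StateIndex : Type := {p : Fin r × (Fin n × Fin 2 → ℕ) // stateWeight k p.2 = a p.1 + b}

theorem toLp_mem_L2OfType {s : 𝓢(Tangent n, Fiber r)} (hs : IsOfType k a b univ s) :
    s.toLp 2 volume ∈ L2OfType k a b := by
  intro θ
  have h := s.coeFn_toLp 2 volume
  filter_upwards [h, (measurePreserving_torusAct k θ).quasiMeasurePreserving.ae h] with z h1 h2
  rw [h1, h2]
  exact hs θ z (mem_univ z)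

/-- The normalized states as elements of the space of sections of type `ρ`. -/
noncomputable def stateSection (p : StateIndex k a b) : L2OfType k a b :=
  ⟨(embed p.1.1 (normState hκ p.1.2)).toLp 2 volume,
    toLp_mem_L2OfType k a b (isOfType_embed_normState hκ p.2 univ)⟩

theorem inner_stateSection (p : StateIndex k a b) (f : L2OfType k a b) :
    ⟪stateSection k a b hκ p, f⟫_ℂ =
      ∫ z, conj (normState hκ p.1.2 z) * (f : Lp (Fiber r) 2 volume) z p.1.1 :=
  inner_embed _ _ _

theorem inner_stateSection_of_ae_eq (p : StateIndex k a b) {f : L2OfType k a b}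
    {s : Tangent n → Fiber r} (hf : (f : Lp (Fiber r) 2 volume) =ᵐ[volume] s) {u : 𝓢(Tangent n, ℂ)}
    (hu : ∀ z, u z = s z p.1.1) :
    ⟪stateSection k a b hκ p, f⟫_ℂ = innerL2 (normState hκ p.1.2) u := by
  rw [inner_stateSection, innerL2_eq_integral]
  refine integral_congr_ae ?_
  filter_upwards [hf] with z hz
  rw [hz, hu]

theorem orthonormal_stateSection : Orthonormal ℂ (stateSection k a b hκ) := by
  classical
  rw [orthonormal_iff_ite]
  intro p q
  rw [inner_stateSection_of_ae_eq k a b hκ p (SchwartzMap.coeFn_toLp _ _ _)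
    (u := component p.1.1 (embed q.1.1 (normState hκ q.1.2))) (fun z => rfl), component_embed]
  by_cases h1 : p.1.1 = q.1.1
  · rw [if_pos h1, innerL2_normState]
    have : p.1.2 = q.1.2 ↔ p = q := by
      rw [Subtype.ext_iff, Prod.ext_iff]
      simp [h1]
    simp only [this]
  · rw [if_neg h1, if_neg fun h => h1 (by rw [h])]
    simp [innerL2_eq_integral]

/-- Each component of an orthogonal section pairs to zero with states of the right weight by
orthogonality and with all others by its type; completeness of the scalar states then applies. -/
theorem span_stateSection_orthogonal :
    (Submodule.span ℂ (range (stateSection k a b hκ)))ᗮ = ⊥ := by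
  rw [Submodule.eq_bot_iff]
  intro f hf
  have hinner : ∀ p, ⟪stateSection k a b hκ p, f⟫_ℂ = 0 := fun p =>
    (Submodule.mem_orthogonal _ _).1 hf _ (Submodule.subset_span ⟨p, rfl⟩)
  have hzero : ∀ j, (fun z => (f : Lp (Fiber r) 2 volume) z j) =ᵐ[volume] 0 := fun j => by
    refine ae_eq_zero_of_integral_state_mul hκ ?_ fun α => ?_
    · have h := Lp.memLp (f : Lp (Fiber r) 2 (volume : Measure (Tangent n)))
      exact ContinuousLinearMap.comp_memLp'
        (f := ⇑(f : Lp (Fiber r) 2 (volume : Measure (Tangent n))))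
        (EuclideanSpace.proj j : Fiber r →L[ℂ] ℂ) h
    · by_cases hα : stateWeight k α = a j + b
      · have h := hinner ⟨(j, α), hα⟩
        rw [inner_stateSection] at h
        simp only [normState, smul_apply, smul_eq_mul, map_mul, mul_assoc] at h
        rw [integral_const_mul, mul_eq_zero] at h
        refine h.resolve_left ?_
        have := norm_state_ne_zero hκ α
        simpa using this
      · exact integral_state_mul_eq_zero a b hκ hα f
  apply Subtype.ext
  apply Lp.ext
  filter_upwards [Lp.coeFn_zero (Fiber r) 2 (volume : Measure (Tangent n)),
    ae_all_iff.2 hzero] with z h0 hz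
  rw [Submodule.coe_zero, h0]
  ext j
  exact hz j

/-- The normalized states as a Hilbert basis of the space of sections of type `ρ`. -/
noncomputable def stateBasis : HilbertBasis (StateIndex k a b) ℂ (L2OfType k a b) :=
  HilbertBasis.mkOfOrthogonalEqBot (orthonormal_stateSection k a b hκ)
    (span_stateSection_orthogonal k a b hκ)

@[simp]
theorem stateBasis_apply (p : StateIndex k a b) :
    stateBasis k a b hκ p = stateSection k a b hκ p := by
  simp [stateBasis]

end L2

end WittenModel

namespace WittenModel

/-! ### Eigenvalues, their parametrization by triples, and the closed model operator. -/

section Spectrum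

variable {n m r : ℕ} {k : Fin n → Fin m → ℤ} {a : Fin r → Fin m → ℤ} {b : Fin m → ℤ}

/-- The constant term of the model operator in the `j`-th component. -/
noncomputable def shift (k : Fin n → Fin m → ℤ) (a : Fin r → Fin m → ℤ) (b : Fin m → ℤ)
    (τ : Fin m → ℝ) (ε : Fin r → Fin n → ℤ) (j : Fin r) : ℝ :=
  2 * pairing b τ + 2 * pairing (a j) τ + 2 * ∑ l, pairing (k l) τ * ε j l

/-- The eigenvalue of the model operator on a state. -/
noncomputable def stateEigenvalue (τ : Fin m → ℝ) (ε : Fin r → Fin n → ℤ)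
    (p : StateIndex k a b) : ℝ :=
  energy (fun l => pairing (k l) τ) p.1.2 + shift k a b τ ε p.1.1

/-- The weight condition paired with `τ` gives `(a_j + b)·τ = ∑ κ_l (α_{l,0} - α_{l,1})`; adding
twice this to the energy cancels `α_{l,1}`. -/
theorem stateEigenvalue_eq (τ : Fin m → ℝ) (ε : Fin r → Fin n → ℤ) (p : StateIndex k a b) :
    stateEigenvalue τ ε p =
      ∑ l, 2 * pairing (k l) τ * (2 * p.1.2 (l, 0) + 1 + ε p.1.1 l) := by
  have h : pairing (stateWeight k p.1.2) τ = pairing (a p.1.1 + b) τ := by rw [p.2]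
  rw [pairing_stateWeight, pairing_add_left] at h
  rw [stateEigenvalue, energy, shift, ← mul_add, add_comm (pairing b τ), ← h, Finset.mul_sum,
    Finset.mul_sum, ← Finset.sum_add_distrib, ← Finset.sum_add_distrib]
  exact Finset.sum_congr rfl fun l _ => by ring

/-- The triple `(j, μ, d)` with `μ_l = α_{l,0} - α_{l,1}` and `d_l = min (α_{l,0}, α_{l,1})`. -/
def stateTriple (p : StateIndex k a b) : Fin r × (Fin n → ℤ) × (Fin n → ℕ) :=
  (p.1.1, fun l => (p.1.2 (l, 0) : ℤ) - p.1.2 (l, 1), fun l => min (p.1.2 (l, 0)) (p.1.2 (l, 1)))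

theorem stateTriple_injective : Function.Injective (stateTriple : StateIndex k a b → _) := by
  rintro ⟨⟨j, α⟩, hα⟩ ⟨⟨j', α'⟩, hα'⟩ h
  simp only [stateTriple, Prod.mk.injEq] at h
  obtain ⟨h1, h2, h3⟩ := h
  have h4 : α = α' := by
    funext ⟨l, i⟩
    have h2 := congrFun h2 l
    have h3 := congrFun h3 l
    fin_cases i
    · change α (l, 0) = α' (l, 0)
      omega
    · change α (l, 1) = α' (l, 1)
      omega
  subst h1 h4
  rfl

theorem eigenvalue_stateTriple (τ : Fin m → ℝ) (ε : Fin r → Fin n → ℤ) (p : StateIndex k a b) :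
    eigenvalue k τ ε (stateTriple p).1 (stateTriple p).2.1 (stateTriple p).2.2 =
      stateEigenvalue τ ε p := by
  rw [stateEigenvalue_eq, eigenvalue, Finset.mul_sum]
  refine Finset.sum_congr rfl fun l _ => ?_
  have h : |(p.1.2 (l, 0) : ℤ) - p.1.2 (l, 1)| + ((p.1.2 (l, 0) : ℤ) - p.1.2 (l, 1)) +
      2 * (min (p.1.2 (l, 0)) (p.1.2 (l, 1)) : ℕ) = 2 * p.1.2 (l, 0) := by
    rcases le_total (p.1.2 (l, 0)) (p.1.2 (l, 1)) with h | h
    · rw [min_eq_left h, abs_of_nonpos (by omega)]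
      ring
    · rw [min_eq_right h, abs_of_nonneg (by omega)]
      ring
  have h' := congrArg (fun x : ℤ => (x : ℝ)) h
  push_cast at h'
  simp only [stateTriple]
  push_cast
  linear_combination 2 * pairing (k l) τ * h'

theorem image_stateTriple (τ : Fin m → ℝ) (ε : Fin r → Fin n → ℤ) (lam : ℝ) :
    stateTriple '' {p : StateIndex k a b | stateEigenvalue τ ε p = lam} =
      eigenTriples k a b τ ε lam := by
  apply Subset.antisymm
  · rintro _ ⟨p, hp, rfl⟩
    exact ⟨p.2, (eigenvalue_stateTriple τ ε p).trans hp⟩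
  · rintro ⟨j, μ, d⟩ ⟨h1, h2⟩
    -- The inverse substitution: `d` plus the positive part of `μ` in one mode, plus the negative
    -- part in the conjugate mode.
    let α : Fin n × Fin 2 → ℕ := fun i =>
      d i.1 + if i.2 = 0 then (μ i.1).toNat else (-μ i.1).toNat
    have hμ : ∀ l, (α (l, 0) : ℤ) - α (l, 1) = μ l := fun l => by
      simp only [α, one_ne_zero, if_true, if_false]
      omega
    have hd : ∀ l, min (α (l, 0)) (α (l, 1)) = d l := fun l => by
      simp only [α, one_ne_zero, if_true, if_false]
      omega
    have hα : stateWeight k α = a j + b := by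
      simp only [stateWeight, hμ]
      exact h1
    have ht : stateTriple (⟨(j, α), hα⟩ : StateIndex k a b) = (j, μ, d) := by
      simp only [stateTriple, hμ, hd]
    refine ⟨⟨(j, α), hα⟩, ?_, ht⟩
    rw [mem_ofPred_eq, ← eigenvalue_stateTriple, ht]
    exact h2

/-- Positivity of the frequencies confines the occupation numbers to a finite box. -/
theorem finite_stateEigenvalue_le {τ : Fin m → ℝ} (hκ : ∀ l, 0 < pairing (k l) τ)
    (ε : Fin r → Fin n → ℤ) (R : ℝ) :
    {p : StateIndex k a b | stateEigenvalue τ ε p ≤ R}.Finite := by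
  -- Summing absolute values gives one energy bound valid for every component `j`.
  let D : ℝ := ∑ j, |R - shift k a b τ ε j|
  let B : Fin n × Fin 2 → ℕ := fun i => ⌈D / pairing (k i.1) τ⌉₊
  have hB : (Prod.snd ⁻¹' Iic B : Set (Fin r × (Fin n × Fin 2 → ℕ))).Finite := by
    rw [← univ_prod]
    exact finite_univ.prod (finite_Iic B)
  refine (hB.preimage Subtype.val_injective.injOn).subset fun p hp => ?_
  rw [mem_ofPred_eq, stateEigenvalue] at hp
  intro i
  have h1 : energy (fun l => pairing (k l) τ) p.1.2 ≤ D :=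
    (le_sub_iff_add_le.2 hp).trans ((le_abs_self _).trans
      (Finset.single_le_sum (f := fun j => |R - shift k a b τ ε j|) (fun _ _ => abs_nonneg _)
        (Finset.mem_univ p.1.1)))
  have h2 : 2 * pairing (k i.1) τ * (p.1.2 (i.1, 0) + p.1.2 (i.1, 1) + 1) ≤ D :=
    (Finset.single_le_sum (f := fun l => 2 * pairing (k l) τ * (p.1.2 (l, 0) + p.1.2 (l, 1) + 1))
      (fun l _ => by have := hκ l; positivity) (Finset.mem_univ i.1)).trans h1
  have h3 : (p.1.2 i : ℝ) ≤ p.1.2 (i.1, 0) + p.1.2 (i.1, 1) := by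
    obtain ⟨l, q⟩ := i
    fin_cases q <;> simp
  have h4 := hκ i.1
  refine Nat.cast_le.1 (le_trans ?_ (Nat.le_ceil (D / pairing (k i.1) τ)))
  rw [le_div_iff₀ h4]
  have h5 : (0 : ℝ) ≤ p.1.2 i := Nat.cast_nonneg _
  nlinarith

variable (S : CliffordGerm k a) {τ : Fin m → ℝ} {β : Tangent n → (Fiber r →L[ℂ] Fiber r)}
  (hβ : S.IsRestriction τ b β) {ε : Fin r → Fin n → ℤ}
  (hε : ∀ j l,
    Complex.I • S.c 0 (realBasis (l, 0)) (S.c 0 (realBasis (l, 1)) (EuclideanSpace.single j 1)) =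
      (ε j l : ℂ) • EuclideanSpace.single j (1 : ℂ))

include hβ hε in
theorem modelOperator_schwartz {s : 𝓢(Tangent n, Fiber r)} (hs : IsOfType k a b univ s)
    (z : Tangent n) (j : Fin r) :
    S.modelOperator τ β s z j =
      (oscillator (fun l => pairing (k l) τ) (component j s) +
        (shift k a b τ ε j : ℂ) • component j s) z := by
  rw [S.modelOperator_eq τ hβ hε (s.smooth _) hs, add_apply, smul_apply, oscillator_apply,
    laplacian_component, component_apply, smul_eq_mul, shift]

include hβ hε in
-- On each component the operator is the oscillator plus a constant: the basis vectors are Schwartz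
-- eigensections, and symmetry of the oscillator against states gives the coefficient identity for
-- every Schwartz section of type `ρ`.
theorem modelGraph_eq_diagonalGraph (hκ : ∀ l, 0 < pairing (k l) τ) :
    modelGraph S τ b β = diagonalGraph (stateBasis k a b hκ) (stateEigenvalue τ ε) := by
  refine closure_span_eq_diagonalGraph _ _ (fun p => ?_) ?_
  · rw [stateBasis_apply]
    have hs := isOfType_embed_normState (a := a) (b := b) hκ p.2 univ
    refine ⟨embed p.1.1 (normState hκ p.1.2), hs, SchwartzMap.coeFn_toLp _ _ _, ?_⟩
    filter_upwards [Lp.coeFn_smul (stateEigenvalue τ ε p : ℂ)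
        (stateSection k a b hκ p : Lp (Fiber r) 2 (volume : Measure (Tangent n))),
      (embed p.1.1 (normState hκ p.1.2)).coeFn_toLp 2 volume] with z h1 h2
    refine h1.trans ?_
    ext j
    rw [modelOperator_schwartz S hβ hε hs, Pi.smul_apply]
    have h3 : (stateSection k a b hκ p : Lp (Fiber r) 2 (volume : Measure (Tangent n))) z =
      embed p.1.1 (normState hκ p.1.2) z := h2
    rw [h3, component_embed, PiLp.smul_apply, ← component_apply, component_embed]
    split_ifs with h
    · subst h
      rw [oscillator_normState, ← add_smul, smul_apply, stateEigenvalue, Complex.ofReal_add]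
    · simp
  · rintro p ⟨s, hs, h1, h2⟩ i
    rw [stateBasis_apply, inner_stateSection_of_ae_eq k a b hκ i h1 (u := component i.1.1 s)
      (fun z => rfl), inner_stateSection_of_ae_eq k a b hκ i h2
      (fun z => (modelOperator_schwartz S hβ hε hs z i.1.1).symm), innerL2_add_right,
      innerL2_smul_right, innerL2_normState_oscillator, stateEigenvalue, Complex.ofReal_add]
    ring

end Spectrum

end WittenModel

/-! ### Assembly of the theorem from the diagonalization. -/

theorem theorem3p6 {n m r : ℕ}
    (k : Fin n → Fin m → ℤ) (a : Fin r → Fin m → ℤ) (b : Fin m → ℤ) (τ : Fin m → ℝ)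
    (hτ : Dense (Set.range fun t : ℝ => fun p : Fin m => ((t * τ p : ℝ) : Real.Angle)))
    (hκ : ∀ l, 0 < pairing (k l) τ)
    (S : CliffordGerm k a)
    (ε : Fin r → Fin n → ℤ)
    (hε : ∀ j l,
      Complex.I • S.c 0 (realBasis (l, 0)) (S.c 0 (realBasis (l, 1)) (EuclideanSpace.single j 1)) =
        (ε j l : ℂ) • EuclideanSpace.single j (1 : ℂ)) :
    (∃ β, S.IsRestriction τ b β) ∧
    ∀ β, S.IsRestriction τ b β →
      (∀ u : Tangent n → Fiber r, ContDiff ℝ ∞ u → IsOfType k a b Set.univ u → ∀ z j,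
        S.modelOperator τ β u z j =
          -(Laplacian.laplacian u z j) +
            ((∑ l, pairing (k l) τ ^ 2 * ‖z l‖ ^ 2 : ℝ) : ℂ) * u z j +
            ((2 * pairing b τ + 2 * pairing (a j) τ +
              2 * ∑ l, pairing (k l) τ * ε j l : ℝ) : ℂ) * u z j) ∧
      graphSpectrum (modelGraph S τ b β) =
        {z : ℂ | ∃ lam : ℝ, (eigenTriples k a b τ ε lam).Nonempty ∧ z = lam} ∧
      ∀ lam : ℝ,
        (eigenTriples k a b τ ε lam).Finite ∧
        FiniteDimensional ℂ (graphEigenspace (modelGraph S τ b β) (lam : ℂ)) ∧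
        Module.finrank ℂ (graphEigenspace (modelGraph S τ b β) (lam : ℂ)) =
          (eigenTriples k a b τ ε lam).ncard := by
  refine ⟨⟨S.restrictedEndo τ b, S.isRestriction_restrictedEndo τ b⟩, fun β hβ =>
    ⟨fun u hu ht => S.modelOperator_eq τ hβ hε hu ht, ?_, fun lam => ?_⟩⟩
  · rw [modelGraph_eq_diagonalGraph S hβ hε hκ,
      graphSpectrum_diagonalGraph _ (finite_stateEigenvalue_le hκ ε)]
    ext z
    simp only [← image_stateTriple, image_nonempty, mem_ofPred_eq]
    constructor
    · rintro ⟨p, hp⟩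
      exact ⟨stateEigenvalue τ ε p, ⟨p, rfl⟩, hp⟩
    · rintro ⟨_, ⟨p, rfl⟩, hp⟩
      exact ⟨p, hp⟩
  · have hfin : {p : StateIndex k a b | stateEigenvalue τ ε p = lam}.Finite :=
      (finite_stateEigenvalue_le hκ ε lam).subset fun p hp => le_of_eq hp
    rw [modelGraph_eq_diagonalGraph S hβ hε hκ, ← image_stateTriple,
      ncard_image_of_injective _ stateTriple_injective]
    exact ⟨hfin.image _, finrank_graphEigenspace_diagonalGraph _ _ lam hfin⟩
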